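/- Let $m\ge 3$ be an integer. A \emph{polygon with $m$ vertices} is a simple closed polygonal curve in the plane with $m$ vertices, listed in counterclockwise order. Given a reference point $O$ on its boundary (a vertex or a point inside an edge), its \emph{turning function} $t:[0,1]\to\mathbb R$ is the step function for which $t(x)$ is the cumulative angle of the counterclockwise tangent with the $x$-axis after a fraction $x$ of the perimeter has been traversed counterclockwise from $O$: its initial value $t(0)\in[0,2\pi)$ is the angle between the $x$-axis and the edge leaving $O$ (the edge containing $O$, if $O$ is not a vertex), and each time a vertex is passed the signed exterior angle at this vertex (in $(-\pi,\pi)$, positive for left turns, negative for right turns) is added. If $O$ is a vertex, the turn at $O$ is not added, so that $t(1)$ is the value on the edge arriving at $O$. The \emph{span} of $t$ is $\operatorname{span}(t)=\max_{x\in[0,1]}t(x)-\min_{x\in[0,1]}t(x)$. Put $\lambda_m=(2\lfloor m/2\rfloor+2)\pi$. \textbf{Theorem.} For every polygon $Q$ with $m$ vertices (consecutive collinear vertices being allowed) and every reference point on its boundary, the turning function $t_Q$ satisfies $$\operatorname{span}(t_Q)\le\left(\lfloor m/2\rfloor+1\right)\pi=\lambda_m/2 .$$ Moreover, this bound is tight: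 for every $\varepsilon>0$ there exist a polygon $P$ with exactly $m$ vertices, no three consecutive of which are collinear, and a reference point on its boundary, such that its turning function $t_P$ satisfies $$\operatorname{span}(t_P)\ge\left(\lfloor m/2\rfloor+1\right)\pi-\varepsilon .$$ -/

import Mathlib

/-!
Polygons in the Euclidean plane `ℂ` are closed polygonal curves given by their cyclic sequence of
vertices (`Polygon ℂ n`, with edge `i` running from vertex `i` to vertex `i + 1`).
-/

open scoped Real

noncomputable section

namespace Polygon

variable {n : ℕ} [NeZero n]

/-- The polygon is simple: its boundary is traversed without self-intersection, i.e. the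
parametrization of the boundary by half-open edges is injective. -/
def IsSimple (P : Polygon ℂ n) : Prop :=
  Set.InjOn (fun q : Fin n × ℝ => P.edgePath ℝ q.1 q.2) (Set.univ ×ˢ Set.Ico (0 : ℝ) 1)

/-- The signed area enclosed by the polygon (shoelace formula). -/
def signedArea (P : Polygon ℂ n) : ℝ :=
  (∑ i : Fin n, ((P i).re * (P (i + 1)).im - (P (i + 1)).re * (P i).im)) / 2

/-- The vertices are listed in counterclockwise order. -/
def IsCounterclockwise (P : Polygon ℂ n) : Prop := 0 < P.signedArea

/-- The `k`-th edge vector met when the boundary is traversed starting on edge `i`. -/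
def edgeVec (P : Polygon ℂ n) (i : Fin n) (k : ℕ) : ℂ :=
  P (i + Fin.ofNat n (k + 1)) - P (i + Fin.ofNat n k)

/-- Distance along the boundary from vertex `i` to the `k`-th vertex after it. -/
def arcLength (P : Polygon ℂ n) (i : Fin n) (k : ℕ) : ℝ :=
  ∑ j ∈ Finset.range k, ‖P.edgeVec i j‖

/-- The total length of the boundary. -/
def perimeter (P : Polygon ℂ n) : ℝ := ∑ i : Fin n, ‖P (i + 1) - P i‖

/-- The signed turning angle (in `(-π, π]`, positive for left turns) at the `k`-th vertex after
vertex `i`, between the edge arriving there and the edge leaving it; meant for `1 ≤ k`. -/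
def turn (P : Polygon ℂ n) (i : Fin n) (k : ℕ) : ℝ :=
  Complex.arg (P.edgeVec i k / P.edgeVec i (k - 1))

/-- The turning function of `P` with reference point `O = P i + τ (P (i + 1) - P i)`, `0 ≤ τ < 1`.
Its argument `x ∈ [0, 1]` is the fraction of the perimeter traversed since leaving `O`. Its initial
value is the angle in `[0, 2π)` from the `x`-axis to the edge containing `O`, and the turning angle
of each vertex is added as the vertex is passed. If `O` is a vertex, then the turn at `O` itself is
never added, so that the value at `x = 1` is the direction of the edge arriving at `O`. -/
def turningFunction (P : Polygon ℂ n) (i : Fin n) (τ : ℝ) (x : ℝ) : ℝ :=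
  toIcoMod Real.two_pi_pos 0 (Complex.arg (P.edgeVec i 0)) +
    ∑ k ∈ (Finset.Icc 1 n).filter (fun k =>
        P.arcLength i k ≤ τ * ‖P.edgeVec i 0‖ + x * P.perimeter ∧
        P.arcLength i k < τ * ‖P.edgeVec i 0‖ + P.perimeter),
      P.turn i k

end Polygon

/-- `d` is the span of `f` on `[0, 1]`: the maximum and the minimum of `f` on `[0, 1]` are attained
and differ by `d`. -/
def IsSpan (f : ℝ → ℝ) (d : ℝ) : Prop :=
  ∃ M μ : ℝ, IsGreatest (f '' Set.Icc 0 1) M ∧ IsLeast (f '' Set.Icc 0 1) μ ∧ d = M - μ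

/-- The constant `λ_m = (2 ⌊m/2⌋ + 2) π`. -/
def lambdaConst (m : ℕ) : ℝ := (2 * ((m / 2 : ℕ) : ℝ) + 2) * π

end

/-! Upper bound. A simple counterclockwise polygon turns by `2π` in all
(`Polygon.IsSimple.totalTurn_eq_two_pi`). Two values of the turning function differ by a block of
`k` consecutive turns, each at most `π` in absolute value, hence by at most `kπ`. The other `m - k`
turns complete the block to `2π`, so the block is also at most `(m - k + 2)π` in absolute value. The
smaller of `k` and `m + 2 - k` is at most `⌊m/2⌋ + 1`.

The total turn is found in two stages. Hopf's argument: the direction of `q j - q i` is followed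
over the triangle `i < j`; around a cell belonging to two disjoint edges its changes cancel, because
the four differences lie in one half-plane. So the total turn is twice the angle swept by the
polygon seen from a point `O` inside an edge (`Polygon.IsSimple.totalTurn_eq`). If `O` lies on a
horizontal line missing all vertices, the swept angle counts signed crossings of that line to the
left of `O`. Since the total does not depend on `O`, the crossings alternate in sign along the line,
with the same leftmost sign on every line that is crossed. The area is the integral over all levels
of the sum of sign times abscissa, and this is positive only if the total turn is `2π`.

Tightness. A thin band follows a spiral for `⌊m/2⌋` edges and returns along a copy shrunk by `9/10`.
The outer vertices, both ends included, give `⌊m/2⌋ + 1` consecutive left turns. Flattening the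
picture vertically makes all edges nearly horizontal with alternating directions, so each of these
turns tends to `π`. -/

/-! ### Hopf's argument for closed chains -/

/-- Two complex numbers in a common open half-plane `{z | 0 < f z}`: the argument of their quotient
is the difference of their arguments, measured from the axis of the half-plane. -/
theorem Complex.arg_div_of_pos_functional (f : ℂ →L[ℝ] ℝ) {x y : ℂ} (hx : 0 < f x) (hy : 0 < f y) :
    Complex.arg (y / x) = Complex.arg (⟨f 1, -f Complex.I⟩ * y) -
      Complex.arg (⟨f 1, -f Complex.I⟩ * x) := by
  -- Since `f z = Re (u * z)`, multiplication by `u` carries the half-plane to the right half-plane,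
  -- where arguments lie in `(-π/2, π/2)` and their differences do not wrap around.
  set u : ℂ := ⟨f 1, -f Complex.I⟩ with hu
  have key : ∀ z : ℂ, (u * z).re = f z := by
    intro z
    have hz : z = z.re • (1 : ℂ) + z.im • Complex.I := by
      apply Complex.ext <;> simp
    conv_rhs => rw [hz, map_add, map_smul, map_smul]
    simp [hu]
    ring
  have hux : 0 < (u * x).re := by rw [key]; exact hx
  have huy : 0 < (u * y).re := by rw [key]; exact hy
  have hux0 : u * x ≠ 0 := by intro h; rw [h] at hux; simp at hux
  have huy0 : u * y ≠ 0 := by intro h; rw [h] at huy; simp at huy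
  have hu0 : u ≠ 0 := left_ne_zero_of_mul hux0
  have hax := abs_lt.1 (Complex.abs_arg_lt_pi_div_two_iff.2 (Or.inl hux))
  have hay := abs_lt.1 (Complex.abs_arg_lt_pi_div_two_iff.2 (Or.inl huy))
  have hinv : Complex.arg (u * x)⁻¹ = -Complex.arg (u * x) := by
    rw [Complex.arg_inv, if_neg]
    intro h
    linarith [hax.2, Real.pi_pos]
  have h1 : y / x = (u * y) * (u * x)⁻¹ := by
    rw [← div_eq_mul_inv, mul_div_mul_left _ _ hu0]
  rw [h1, Complex.arg_mul huy0 (inv_ne_zero hux0), hinv, sub_eq_add_neg]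
  rw [hinv]
  constructor <;> linarith [hax.1, hax.2, hay.1, hay.2]

theorem isCompact_segment (x y : ℂ) : IsCompact (segment ℝ x y) := by
  rw [segment_eq_image_lineMap]
  exact isCompact_Icc.image (AffineMap.lineMap_continuous)

/-- A closed polygonal chain `q 0, …, q N = q 0` without self-intersections. -/
def IsSimpleChain (q : ℕ → ℂ) (N : ℕ) : Prop :=
  ∀ i j, i < j → j < N → ∀ s ∈ Set.Icc (0 : ℝ) 1, ∀ t ∈ Set.Icc (0 : ℝ) 1,
    AffineMap.lineMap (q i) (q (i + 1)) s = AffineMap.lineMap (q j) (q (j + 1)) t →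
      (j = i + 1 ∧ s = 1 ∧ t = 0) ∨ (i = 0 ∧ j + 1 = N ∧ s = 0 ∧ t = 1)

/-- If the origin were on the segment joining two consecutive edge vectors, the second edge would
run back along the first. Otherwise the origin can be separated from that segment. -/
theorem IsSimpleChain.exists_functional_adjacent {q : ℕ → ℂ} {N : ℕ} (h : IsSimpleChain q N)
    (hN : 3 ≤ N) {k : ℕ} (hk : k + 2 ≤ N) :
    ∃ f : ℂ →L[ℝ] ℝ, 0 < f (q (k + 1) - q k) ∧ 0 < f (q (k + 2) - q (k + 1)) := by
  have hdisj : Disjoint ({0} : Set ℂ) (segment ℝ (q (k + 1) - q k) (q (k + 2) - q (k + 1))) := by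
    rw [Set.disjoint_singleton_left]
    rintro ⟨a, b, ha, hb, hab, h0⟩
    -- From `a e + b e' = 0` with `a + b = 1`, the point at parameter `1 - a` of the first edge
    -- equals the one at parameter `b` of the second; simplicity would force `a = b = 0`.
    have := h k (k + 1) (by omega) (by omega) (1 - a) ⟨by linarith, by linarith⟩ b
      ⟨hb, by linarith⟩ (by
        simp only [AffineMap.lineMap_apply, vsub_eq_sub, vadd_eq_add, Complex.real_smul] at h0 ⊢
        push_cast
        linear_combination -h0)
    rcases this with ⟨-, h1, h2⟩ | ⟨h1, h2, -⟩
    · linarith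
    · omega
  obtain ⟨f, u, v, hu, huv, hv⟩ := geometric_hahn_banach_compact_closed (convex_singleton (0 : ℂ))
    isCompact_singleton (convex_segment _ _) (isCompact_segment _ _).isClosed hdisj
  have h0 := hu 0 rfl
  rw [map_zero] at h0
  exact ⟨f, (h0.trans huv).trans (hv _ (left_mem_segment ℝ _ _)),
    (h0.trans huv).trans (hv _ (right_mem_segment ℝ _ _))⟩

/-- Disjoint compact convex sets are strictly separated, so all differences between them lie in one
open half-plane. The first and last edges are excluded because they meet at `q 0`. -/
theorem IsSimpleChain.exists_functional_far {q : ℕ → ℂ} {N : ℕ} (h : IsSimpleChain q N)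
    {i j : ℕ} (hij : i + 1 < j) (hj : j < N) (h0 : ¬ (i = 0 ∧ j + 1 = N)) :
    ∃ f : ℂ →L[ℝ] ℝ, 0 < f (q j - q i) ∧ 0 < f (q (j + 1) - q i) ∧
      0 < f (q j - q (i + 1)) ∧ 0 < f (q (j + 1) - q (i + 1)) := by
  have hdisj : Disjoint (segment ℝ (q i) (q (i + 1))) (segment ℝ (q j) (q (j + 1))) := by
    rw [Set.disjoint_left]
    intro z hz hz'
    rw [segment_eq_image_lineMap] at hz hz'
    obtain ⟨s, hs, rfl⟩ := hz
    obtain ⟨t, ht, hst⟩ := hz'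
    rcases h i j (by omega) hj s hs t ht hst.symm with ⟨h1, -⟩ | ⟨h1, h2, -⟩
    · omega
    · exact h0 ⟨h1, h2⟩
  obtain ⟨f, u, v, hu, huv, hv⟩ := geometric_hahn_banach_compact_closed (convex_segment _ _)
    (isCompact_segment _ _) (convex_segment _ _) (isCompact_segment _ _).isClosed hdisj
  have a1 := hu _ (left_mem_segment ℝ _ _)
  have a2 := hu _ (right_mem_segment ℝ _ _)
  have b1 := hv _ (left_mem_segment ℝ _ _)
  have b2 := hv _ (right_mem_segment ℝ _ _)
  refine ⟨f, ?_, ?_, ?_, ?_⟩ <;> rw [map_sub] <;> linarith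

/-- Discrete form of Hopf's theorem on turning tangents: the turning angles of a simple closed chain
at all vertices but `q 0` are expressed by the angle swept by the chain seen from `q 0`. -/
theorem IsSimpleChain.sum_turn_eq {q : ℕ → ℂ} {M : ℕ} (h : IsSimpleChain q (M + 3))
    (hq : q (M + 3) = q 0) :
    ∑ k ∈ Finset.range (M + 2), Complex.arg ((q (k + 2) - q (k + 1)) / (q (k + 1) - q k)) =
      2 * ∑ l ∈ Finset.range (M + 1), Complex.arg ((q (l + 2) - q 0) / (q (l + 1) - q 0)) +
        (Complex.arg ((q (M + 2) - q 1) / (q (M + 2) - q 0)) +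
          Complex.arg ((q 0 - q 1) / (q (M + 2) - q 1))) := by
  obtain ⟨H, hH⟩ : ∃ H : ℕ → ℕ → ℝ,
      ∀ i j, H i j = Complex.arg ((q (j + 1) - q i) / (q j - q i)) := ⟨_, fun _ _ => rfl⟩
  obtain ⟨V, hV⟩ : ∃ V : ℕ → ℕ → ℝ,
      ∀ i j, V i j = Complex.arg ((q j - q (i + 1)) / (q j - q i)) := ⟨_, fun _ _ => rfl⟩
  obtain ⟨T, hT⟩ : ∃ T : ℕ → ℝ,
      ∀ k, T k = Complex.arg ((q (k + 2) - q (k + 1)) / (q (k + 1) - q k)) := ⟨_, fun _ => rfl⟩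
  -- `H` and `V` record the change of direction of `q j - q i` when `j`, respectively `i`, advances
  -- by one. A turn is one horizontal and one vertical step next to the diagonal.
  have tri : ∀ k, k + 2 ≤ M + 3 → T k = H k (k + 1) + V k (k + 2) := by
    intro k hk
    obtain ⟨f, h1, h2⟩ := h.exists_functional_adjacent (by omega) hk
    have h3 : 0 < f (q (k + 2) - q k) := by
      have : q (k + 2) - q k = (q (k + 2) - q (k + 1)) + (q (k + 1) - q k) := by ring
      rw [this, map_add]
      linarith
    rw [hT, hH, hV, Complex.arg_div_of_pos_functional f h1 h2,
      Complex.arg_div_of_pos_functional f h1 h3, Complex.arg_div_of_pos_functional f h3 h2]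
    ring
  -- The two ways around a cell give the same change of direction.
  have cell : ∀ i j, i + 1 < j → j < M + 3 → ¬ (i = 0 ∧ j + 1 = M + 3) →
      H i j + V i (j + 1) = V i j + H (i + 1) j := by
    intro i j hij hj h0
    obtain ⟨f, h1, h2, h3, h4⟩ := h.exists_functional_far hij hj h0
    rw [hH, hH, hV, hV, Complex.arg_div_of_pos_functional f h1 h2,
      Complex.arg_div_of_pos_functional f h2 h4, Complex.arg_div_of_pos_functional f h1 h3,
      Complex.arg_div_of_pos_functional f h3 h4]
    ring
  -- The staircase along the diagonal is deformed to the two legs of the triangle.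
  have claim : ∀ J, J + 2 ≤ M + 3 → ∑ k ∈ Finset.range J, T k =
      ∑ l ∈ Finset.range J, H 0 (l + 1) + ∑ i ∈ Finset.range J, V i (J + 1) := by
    intro J
    induction J with
    | zero => simp
    | succ J ih =>
      intro hJ
      have h1 := ih (by omega)
      have h2 : ∑ i ∈ Finset.range J, (H i (J + 1) + V i (J + 2)) =
          ∑ i ∈ Finset.range J, (V i (J + 1) + H (i + 1) (J + 1)) := by
        refine Finset.sum_congr rfl fun i hi => ?_
        have := Finset.mem_range.1 hi
        exact cell i (J + 1) (by omega) (by omega) (by omega)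
      have h3 := Finset.sum_range_sub (fun i => H i (J + 1)) J
      rw [Finset.sum_add_distrib, Finset.sum_add_distrib] at h2
      rw [Finset.sum_sub_distrib] at h3
      have h4 := tri J (by omega)
      rw [Finset.sum_range_succ, Finset.sum_range_succ, Finset.sum_range_succ]
      linarith
  have c1 := claim (M + 1) (by omega)
  have c2 := tri (M + 1) (by omega)
  have h2 : ∑ i ∈ Finset.range M, (H (i + 1) (M + 2) + V (i + 1) (M + 3)) =
      ∑ i ∈ Finset.range M, (V (i + 1) (M + 2) + H (i + 1 + 1) (M + 2)) := by
    refine Finset.sum_congr rfl fun i hi => ?_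
    have := Finset.mem_range.1 hi
    exact cell (i + 1) (M + 2) (by omega) (by omega) (by omega)
  have h3 := Finset.sum_range_sub (fun i => H (i + 1) (M + 2)) M
  rw [Finset.sum_add_distrib, Finset.sum_add_distrib] at h2
  rw [Finset.sum_sub_distrib] at h3
  -- Reversing both vectors does not change their quotient: the leg ending at `q (M + 3) = q 0`
  -- repeats the leg starting at `q 0`. This is the source of the factor 2.
  have h4 : ∑ i ∈ Finset.range (M + 1), V (i + 1) (M + 3) =
      ∑ l ∈ Finset.range (M + 1), H 0 (l + 1) := by
    refine Finset.sum_congr rfl fun i _ => ?_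
    rw [hV, hH, hq, ← neg_sub, ← neg_sub (q (i + 1)) (q 0), neg_div_neg_eq]
  have e1 : Complex.arg ((q (M + 2) - q 1) / (q (M + 2) - q 0)) = V 0 (M + 2) := (hV _ _).symm
  have e2 : Complex.arg ((q 0 - q 1) / (q (M + 2) - q 1)) = H 1 (M + 2) := by rw [hH, ← hq]
  rw [e1, e2]
  simp only [← hT]
  have e3 : ∀ l, Complex.arg ((q (l + 2) - q 0) / (q (l + 1) - q 0)) = H 0 (l + 1) :=
    fun l => (hH _ _).symm
  simp only [e3]
  rw [Finset.sum_range_succ] at h4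
  rw [Finset.sum_range_succ' (fun i => V i (M + 1 + 1))] at c1
  rw [Finset.sum_range_succ]
  simp only [zero_add] at *
  linarith

/-! ### Polygons as simple chains based at a point inside an edge -/

noncomputable section

theorem Fin.ofNat_succ_eq (n : ℕ) [NeZero n] (k : ℕ) :
    Fin.ofNat n (k + 1) = Fin.ofNat n k + 1 := by
  ext; simp [Fin.val_add]

theorem Fin.ofNat_add_self (n : ℕ) [NeZero n] (k : ℕ) :
    Fin.ofNat n (k + n) = Fin.ofNat n k := by
  ext; simp

theorem finRotate_eq_add_one (n : ℕ) [NeZero n] (i : Fin n) : finRotate n i = i + 1 := by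
  exact finRotate_apply i

namespace Polygon

variable {n : ℕ} [NeZero n]

/-- The `k`-th vertex after vertex `i`. -/
def vertexFrom (P : Polygon ℂ n) (i : Fin n) (k : ℕ) : ℂ := P (i + Fin.ofNat n k)

theorem edgeVec_eq (P : Polygon ℂ n) (i : Fin n) (k : ℕ) :
    P.edgeVec i k = P.vertexFrom i (k + 1) - P.vertexFrom i k := rfl

theorem vertexFrom_zero (P : Polygon ℂ n) (i : Fin n) : P.vertexFrom i 0 = P i := by
  unfold vertexFrom
  congr 1
  ext; simp

theorem vertexFrom_succ (P : Polygon ℂ n) (i : Fin n) (k : ℕ) :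
    P.vertexFrom i (k + 1) = P (i + Fin.ofNat n k + 1) := by
  rw [vertexFrom, Fin.ofNat_succ_eq, add_assoc]

theorem vertexFrom_add_self (P : Polygon ℂ n) (i : Fin n) (k : ℕ) :
    P.vertexFrom i (k + n) = P.vertexFrom i k := by
  rw [vertexFrom, Fin.ofNat_add_self, vertexFrom]

theorem IsSimple.lineMap_injective {P : Polygon ℂ n} (h : P.IsSimple) (i : Fin n) {k l : ℕ}
    {s t : ℝ} (hs : s ∈ Set.Ico (0 : ℝ) 1) (ht : t ∈ Set.Ico (0 : ℝ) 1)
    (heq : AffineMap.lineMap (P.vertexFrom i k) (P.vertexFrom i (k + 1)) s =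
      AffineMap.lineMap (P.vertexFrom i l) (P.vertexFrom i (l + 1)) t) :
    k ≡ l [MOD n] ∧ s = t := by
  have := h (x₁ := (i + Fin.ofNat n k, s)) (x₂ := (i + Fin.ofNat n l, t))
    ⟨Set.mem_univ _, hs⟩ ⟨Set.mem_univ _, ht⟩ (by
      simp only [edgePath, finRotate_eq_add_one]
      rwa [vertexFrom_succ, vertexFrom_succ] at heq)
  rw [Prod.mk.injEq, add_right_inj] at this
  refine ⟨?_, this.2⟩
  have := congrArg Fin.val this.1
  simpa [Nat.ModEq] using this

/-- The boundary of `P` as a path starting at vertex `i` and traversing each edge in unit time. -/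
def path (P : Polygon ℂ n) (i : Fin n) (x : ℝ) : ℂ :=
  AffineMap.lineMap (P.vertexFrom i ⌊x⌋₊) (P.vertexFrom i (⌊x⌋₊ + 1)) (Int.fract x)

theorem path_nat_add (P : Polygon ℂ n) (i : Fin n) (k : ℕ) {s : ℝ} (hs : s ∈ Set.Icc (0 : ℝ) 1) :
    P.path i (k + s) =
      AffineMap.lineMap (P.vertexFrom i k) (P.vertexFrom i (k + 1)) s := by
  rcases hs.2.lt_or_eq with h1 | rfl
  · have hf : ⌊(k : ℝ) + s⌋₊ = k := by
      rw [Nat.floor_eq_iff (add_nonneg k.cast_nonneg hs.1)]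
      constructor <;> linarith [hs.1]
    rw [path, hf, Int.fract_natCast_add, Int.fract_eq_self.2 ⟨hs.1, h1⟩]
  · have hf : ⌊(k : ℝ) + 1⌋₊ = k + 1 := by exact_mod_cast Nat.floor_natCast (R := ℝ) (k + 1)
    have hr : Int.fract ((k : ℝ) + 1) = 0 := by simp
    rw [path, hf, hr]
    simp

theorem IsSimple.path_ne {P : Polygon ℂ n} (h : P.IsSimple) (i : Fin n) {x y : ℝ} (hx : 0 ≤ x)
    (hxy : x < y) (hyx : y < x + n) : P.path i x ≠ P.path i y := by
  intro heq
  obtain ⟨h1, h2⟩ := h.lineMap_injective i ⟨Int.fract_nonneg _, Int.fract_lt_one _⟩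
    ⟨Int.fract_nonneg _, Int.fract_lt_one _⟩ heq
  have e : ∀ z : ℝ, 0 ≤ z → z = ⌊z⌋₊ + Int.fract z := by
    intro z hz
    rw [natCast_floor_eq_intCast_floor hz, Int.floor_add_fract]
  have ex := e x hx
  have ey := e y (hx.trans hxy.le)
  set a := ⌊x⌋₊
  set b := ⌊y⌋₊
  have hab : a < b := by
    have : (a : ℝ) < b := by linarith
    exact_mod_cast this
  have hba : b < a + n := by
    have : (b : ℝ) < a + n := by linarith
    exact_mod_cast this
  have hd := (Nat.modEq_iff_dvd' hab.le).1 h1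
  have := Nat.le_of_dvd (by omega) hd
  omega

/-- The vertices of `P`, starting with the point `P i + τ (P (i + 1) - P i)` on edge `i` and
returning to it. -/
def chainFrom (P : Polygon ℂ n) (i : Fin n) (τ : ℝ) (k : ℕ) : ℂ :=
  if 1 ≤ k ∧ k ≤ n then P.vertexFrom i k else
    AffineMap.lineMap (P.vertexFrom i 0) (P.vertexFrom i 1) τ

theorem chainFrom_zero (P : Polygon ℂ n) (i : Fin n) (τ : ℝ) : P.chainFrom i τ 0 =
    AffineMap.lineMap (P.vertexFrom i 0) (P.vertexFrom i 1) τ := by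
  simp [chainFrom]

theorem chainFrom_succ_self (P : Polygon ℂ n) (i : Fin n) (τ : ℝ) : P.chainFrom i τ (n + 1) =
    AffineMap.lineMap (P.vertexFrom i 0) (P.vertexFrom i 1) τ := by
  simp [chainFrom]

theorem chainFrom_of_mem (P : Polygon ℂ n) (i : Fin n) (τ : ℝ) {k : ℕ} (h1 : 1 ≤ k) (hk : k ≤ n) :
    P.chainFrom i τ k = P.vertexFrom i k := by
  simp [chainFrom, h1, hk]

/-- The chain is `path` run over the time interval `[τ, n + τ]`, which is one full period; `T k` is
the time at which its `k`-th vertex is reached. `path` takes equal values only at times at least a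
period apart. -/
theorem IsSimple.isSimpleChain_chainFrom {P : Polygon ℂ n} (h : P.IsSimple) (i : Fin n) {τ : ℝ}
    (h0 : 0 < τ) (h1 : τ < 1) : IsSimpleChain (P.chainFrom i τ) (n + 1) := by
  have hn : 1 ≤ n := Nat.one_le_iff_ne_zero.2 (NeZero.ne n)
  obtain ⟨T, hT⟩ : ∃ T : ℕ → ℝ, ∀ k, T k = if k = 0 then τ else if k = n + 1 then n + τ else k :=
    ⟨_, fun _ => rfl⟩
  have T0 : T 0 = τ := by simp [hT]
  have Tn : T (n + 1) = n + τ := by simp [hT]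
  have Tk : ∀ k, 1 ≤ k → k ≤ n → T k = k := by
    intro k h1 h2
    rw [hT, if_neg (by omega), if_neg (by omega)]
  have step : ∀ k, k ≤ n → T k < T (k + 1) := by
    intro k hk
    rcases Nat.eq_zero_or_pos k with rfl | hk0
    · rw [T0, Tk 1 le_rfl hn]; simpa using h1
    · rcases hk.lt_or_eq with hk' | rfl
      · rw [Tk k hk0 hk, Tk (k + 1) (by omega) (by omega)]; push_cast; linarith
      · rw [Tk k hk0 hk, Tn]; linarith
  have mono : ∀ d a, a + d ≤ n + 1 → T a ≤ T (a + d) := by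
    intro d
    induction d with
    | zero => intros; simp
    | succ d ih => exact fun a ha => (ih a (by omega)).trans (step (a + d) (by omega)).le
  have mono' : ∀ a b, a ≤ b → b ≤ n + 1 → T a ≤ T b := by
    intro a b hab hb
    obtain ⟨d, rfl⟩ := Nat.exists_eq_add_of_le hab
    exact mono d a hb
  have hpath : ∀ k, k ≤ n → ∀ s ∈ Set.Icc (0 : ℝ) 1,
      AffineMap.lineMap (P.chainFrom i τ k) (P.chainFrom i τ (k + 1)) s =
        P.path i (T k + s * (T (k + 1) - T k)) := by
    intro k hk s hs
    rcases Nat.eq_zero_or_pos k with rfl | hk0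
    · have hmem : τ + s * (1 - τ) ∈ Set.Icc (0 : ℝ) 1 :=
        ⟨by nlinarith [hs.1], by nlinarith [hs.2]⟩
      have := P.path_nat_add i 0 hmem
      rw [T0, Tk 1 le_rfl hn]
      simp only [Nat.cast_zero, zero_add, Nat.cast_one] at this ⊢
      rw [this, chainFrom_zero, chainFrom_of_mem P i τ le_rfl hn]
      simp only [AffineMap.lineMap_apply, vsub_eq_sub, vadd_eq_add, Complex.real_smul]
      push_cast
      ring
    · rcases hk.lt_or_eq with hk' | rfl
      · rw [Tk k hk0 hk, Tk (k + 1) (by omega) (by omega), chainFrom_of_mem P i τ hk0 hk,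
          chainFrom_of_mem P i τ (by omega) hk', ← P.path_nat_add i k hs]
        congr 1
        push_cast
        ring
      · have hmem : s * τ ∈ Set.Icc (0 : ℝ) 1 :=
          ⟨mul_nonneg hs.1 h0.le, by nlinarith [hs.2, hs.1]⟩
        have e0 := P.vertexFrom_add_self i 0
        have e1 := P.vertexFrom_add_self i 1
        rw [zero_add] at e0
        rw [add_comm] at e1
        rw [Tk k hk0 hk, Tn, chainFrom_succ_self, chainFrom_of_mem P i τ hk0 le_rfl,
          show (k : ℝ) + s * (k + τ - k) = k + s * τ by ring, P.path_nat_add i k hmem, e0, e1]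
        simp only [AffineMap.lineMap_apply, vsub_eq_sub, vadd_eq_add, Complex.real_smul]
        push_cast
        ring
  intro a b hab hb s hs t ht heq
  rw [hpath a (by omega) s hs, hpath b (by omega) t ht] at heq
  set x := T a + s * (T (a + 1) - T a) with hx
  set y := T b + t * (T (b + 1) - T b) with hy
  have da := step a (by omega)
  have db := step b (by omega)
  have m1 := mono' 0 a (by omega) (by omega)
  have m2 := mono' (a + 1) b (by omega) (by omega)
  have m3 := mono' (b + 1) (n + 1) (by omega) le_rfl
  have x1 : T a ≤ x := by nlinarith [hs.1]
  have x2 : x ≤ T (a + 1) := by nlinarith [hs.2]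
  have y1 : T b ≤ y := by nlinarith [ht.1]
  have y2 : y ≤ T (b + 1) := by nlinarith [ht.2]
  rcases (show x ≤ y by linarith).lt_or_eq with hlt | heq'
  · right
    -- All times lie in `[τ, n + τ]`, so a difference of at least `n` forces `x` and `y` to be the
    -- two ends of the interval.
    have hge : x + n ≤ y := by
      by_contra hcon
      exact h.path_ne i (by linarith) hlt (by linarith) heq
    have s0 : s * (T (a + 1) - T a) = 0 := by nlinarith [hs.1]
    have t1 : (1 - t) * (T (b + 1) - T b) = 0 := by nlinarith [ht.2]
    refine ⟨?_, ?_, ?_, ?_⟩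
    · by_contra ha
      have := mono' 1 a (by omega) (by omega)
      have := step 0 (by omega)
      rw [zero_add] at this
      linarith
    · by_contra hb'
      have := mono' (b + 1) n (by omega) (by omega)
      have := step n le_rfl
      linarith
    · rcases mul_eq_zero.1 s0 with h | h
      · exact h
      · linarith
    · rcases mul_eq_zero.1 t1 with h | h
      · linarith
      · linarith
  · left
    have s0 : (1 - s) * (T (a + 1) - T a) = 0 := by nlinarith [hs.2]
    have t1 : t * (T (b + 1) - T b) = 0 := by nlinarith [ht.1]
    refine ⟨?_, ?_, ?_⟩
    · by_contra hne
      have := mono' (a + 2) b (by omega) (by omega)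
      have := step (a + 1) (by omega)
      linarith
    · rcases mul_eq_zero.1 s0 with h | h <;> linarith
    · rcases mul_eq_zero.1 t1 with h | h <;> linarith

end Polygon

/-! ### Swept angles and crossings of a horizontal line -/

theorem Complex.arg_div_eq_of_mem_Ioc {a b : ℂ} (ha : a ≠ 0) (hb : b ≠ 0) (c : ℤ)
    (h : Complex.arg b - Complex.arg a + c * (2 * π) ∈ Set.Ioc (-π) π) :
    Complex.arg (b / a) = Complex.arg b - Complex.arg a + c * (2 * π) := by
  rw [← Complex.arg_coe_angle_toReal_eq_arg, Complex.arg_div_coe_angle hb ha, ← Real.Angle.coe_sub]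
  have : ((Complex.arg b - Complex.arg a : ℝ) : Real.Angle) =
      ((Complex.arg b - Complex.arg a + c * (2 * π) : ℝ) : Real.Angle) := by
    rw [Real.Angle.angle_eq_iff_two_pi_dvd_sub]
    exact ⟨-c, by push_cast; ring⟩
  rw [this, Real.Angle.toReal_coe_eq_self_iff_mem_Ioc.2 h]

theorem Complex.arg_mem_Ioo_of_im_pos {a : ℂ} (ha : 0 < a.im) : Complex.arg a ∈ Set.Ioo 0 π := by
  refine ⟨lt_of_le_of_ne (Complex.arg_nonneg_iff.2 ha.le) ?_, ?_⟩
  · intro h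
    have := (Complex.arg_eq_zero_iff.1 h.symm).2
    linarith
  · refine lt_of_le_of_ne (Complex.arg_le_pi a) fun h => ?_
    have := (Complex.arg_eq_pi_iff.1 h).2
    linarith

theorem Complex.arg_mem_Ioo_of_im_neg {a : ℂ} (ha : a.im < 0) :
    Complex.arg a ∈ Set.Ioo (-π) 0 :=
  ⟨Complex.neg_pi_lt_arg a, Complex.arg_neg_iff.2 ha⟩

theorem Complex.norm_mul_norm_mul_sin_arg_sub (a b : ℂ) :
    ‖a‖ * ‖b‖ * Real.sin (Complex.arg b - Complex.arg a) = a.re * b.im - a.im * b.re := by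
  rw [Real.sin_sub]
  have h1 := Complex.norm_mul_cos_arg a
  have h2 := Complex.norm_mul_sin_arg a
  have h3 := Complex.norm_mul_cos_arg b
  have h4 := Complex.norm_mul_sin_arg b
  rw [← h1, ← h2, ← h3, ← h4]
  ring

/-- Change of the principal argument across the negative real axis. -/
theorem Complex.arg_div_of_im_pos_of_im_neg {a b : ℂ} (ha : 0 < a.im) (hb : b.im < 0)
    (hab : a.re * b.im - a.im * b.re ≠ 0) :
    Complex.arg (b / a) = Complex.arg b - Complex.arg a +
      (if 0 < a.re * b.im - a.im * b.re then 2 * π else 0) ∧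
    Complex.arg (a / b) = Complex.arg a - Complex.arg b -
      (if 0 < a.re * b.im - a.im * b.re then 2 * π else 0) := by
  have ha0 : a ≠ 0 := by rintro rfl; simp at ha
  have hb0 : b ≠ 0 := by rintro rfl; simp at hb
  have h1 := Complex.arg_mem_Ioo_of_im_pos ha
  have h2 := Complex.arg_mem_Ioo_of_im_neg hb
  have hn : 0 < ‖a‖ * ‖b‖ := mul_pos (norm_pos_iff.2 ha0) (norm_pos_iff.2 hb0)
  have hs := Complex.norm_mul_norm_mul_sin_arg_sub a b
  split_ifs with hc
  · have hd : Complex.arg b - Complex.arg a < -π := by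
      by_contra hcon
      have : 0 ≤ Real.sin (-(Complex.arg b - Complex.arg a)) :=
        Real.sin_nonneg_of_nonneg_of_le_pi (by linarith [h1.1, h2.2]) (by linarith)
      rw [Real.sin_neg] at this
      nlinarith
    have e1 := Complex.arg_div_eq_of_mem_Ioc ha0 hb0 1 (by
      constructor <;> push_cast <;> linarith [h1.1, h1.2, h2.1, h2.2])
    have e2 := Complex.arg_div_eq_of_mem_Ioc hb0 ha0 (-1) (by
      constructor <;> push_cast <;> linarith [h1.1, h1.2, h2.1, h2.2])
    rw [e1, e2]
    constructor <;> push_cast <;> ring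
  · have hd : -π < Complex.arg b - Complex.arg a := by
      by_contra hcon
      have : 0 ≤ Real.sin (Complex.arg b - Complex.arg a + 2 * π) :=
        Real.sin_nonneg_of_nonneg_of_le_pi (by linarith [h1.2, h2.1]) (by linarith)
      rw [Real.sin_add_two_pi] at this
      exact hc (lt_of_le_of_ne (by rw [← hs]; positivity) hab.symm)
    have e1 := Complex.arg_div_eq_of_mem_Ioc ha0 hb0 0 (by
      constructor <;> push_cast <;> linarith [h1.1, h1.2, h2.1, h2.2])
    have e2 := Complex.arg_div_eq_of_mem_Ioc hb0 ha0 0 (by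
      constructor <;> push_cast <;> linarith [h1.1, h1.2, h2.1, h2.2])
    rw [e1, e2]
    constructor <;> push_cast <;> ring

/-- The signed number of upward crossings of the level `y` by the segment from `z` to `w`. -/
def crossingSign (y : ℝ) (z w : ℂ) : ℝ :=
  (if y < w.im then 1 else 0) - (if y < z.im then 1 else 0)

/-- The abscissa at which the line through `z` and `w` meets the level `y`. -/
def crossingRe (y : ℝ) (z w : ℂ) : ℝ :=
  z.re + (y - z.im) / (w.im - z.im) * (w.re - z.re)

/-- The branch cut of the argument around `o` is the horizontal ray to its left. The true angle from
`z` to `w` differs from the difference of principal arguments by a full turn exactly when the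
segment crosses this ray; an upward crossing makes the principal argument jump by `2π`. -/
theorem arg_sub_div_sub_eq {o z w : ℂ} (hz : z.im ≠ o.im) (hw : w.im ≠ o.im)
    (hx : crossingSign o.im z w ≠ 0 → crossingRe o.im z w ≠ o.re) :
    Complex.arg ((w - o) / (z - o)) = Complex.arg (w - o) - Complex.arg (z - o) -
      2 * π * (if crossingRe o.im z w < o.re then crossingSign o.im z w else 0) := by
  have hz0 : z - o ≠ 0 := by
    intro h; rw [sub_eq_zero] at h; exact hz (by rw [h])
  have hw0 : w - o ≠ 0 := by
    intro h; rw [sub_eq_zero] at h; exact hw (by rw [h])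
  have cross : ∀ D : ℝ, D = w.im - z.im → D ≠ 0 →
      (z - o).re * (w - o).im - (z - o).im * (w - o).re = D * (crossingRe o.im z w - o.re) := by
    intro D hD hD0
    rw [crossingRe, ← hD]
    field_simp
    simp only [Complex.sub_re, Complex.sub_im]
    rw [hD]
    ring
  rcases lt_or_gt_of_ne hz with hz' | hz' <;> rcases lt_or_gt_of_ne hw with hw' | hw'
  · have hs : crossingSign o.im z w = 0 := by simp [crossingSign, hz'.le.not_gt, hw'.le.not_gt]
    have h1 := Complex.arg_mem_Ioo_of_im_neg (a := z - o) (by simpa using hz')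
    have h2 := Complex.arg_mem_Ioo_of_im_neg (a := w - o) (by simpa using hw')
    have e := Complex.arg_div_eq_of_mem_Ioc hz0 hw0 0 (by
      constructor <;> push_cast <;> linarith [h1.1, h1.2, h2.1, h2.2])
    rw [e, hs]
    simp
  · have hs : crossingSign o.im z w = 1 := by simp [crossingSign, hz'.le.not_gt, hw']
    have hx' := hx (by rw [hs]; norm_num)
    have hc := cross _ rfl (by linarith)
    have hD : 0 < w.im - z.im := by linarith
    have hc' : (w - o).re * (z - o).im - (w - o).im * (z - o).re =
        -((w.im - z.im) * (crossingRe o.im z w - o.re)) := by rw [← hc]; ring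
    rw [(Complex.arg_div_of_im_pos_of_im_neg (a := w - o) (b := z - o) (by simpa using hw')
      (by simpa using hz') (by
        rw [hc']
        exact neg_ne_zero.2 (mul_ne_zero hD.ne' (sub_ne_zero.2 hx')))).2, hc', hs]
    have : 0 < -((w.im - z.im) * (crossingRe o.im z w - o.re)) ↔ crossingRe o.im z w < o.re := by
      rw [← mul_neg, mul_pos_iff_of_pos_left hD]
      constructor <;> intro h <;> linarith
    simp only [this]
    split_ifs <;> ring
  · have hs : crossingSign o.im z w = -1 := by simp [crossingSign, hz', hw'.le.not_gt]
    have hx' := hx (by rw [hs]; norm_num)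
    have hc := cross _ rfl (by linarith)
    have hD : w.im - z.im < 0 := by linarith
    rw [(Complex.arg_div_of_im_pos_of_im_neg (a := z - o) (b := w - o) (by simpa using hz')
      (by simpa using hw') (by
        rw [hc]
        exact mul_ne_zero hD.ne (sub_ne_zero.2 hx'))).1, hc, hs]
    have : 0 < (w.im - z.im) * (crossingRe o.im z w - o.re) ↔ crossingRe o.im z w < o.re := by
      rw [← neg_mul_neg, mul_pos_iff_of_pos_left (neg_pos.2 hD)]
      constructor <;> intro h <;> linarith
    simp only [this]
    split_ifs <;> ring
  · have hs : crossingSign o.im z w = 0 := by simp [crossingSign, hz', hw']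
    have h1 := Complex.arg_mem_Ioo_of_im_pos (a := z - o) (by simpa using hz')
    have h2 := Complex.arg_mem_Ioo_of_im_pos (a := w - o) (by simpa using hw')
    have e := Complex.arg_div_eq_of_mem_Ioc hz0 hw0 0 (by
      constructor <;> push_cast <;> linarith [h1.1, h1.2, h2.1, h2.2])
    rw [e, hs]
    simp

theorem Complex.lineMap_re (z w : ℂ) (t : ℝ) :
    (AffineMap.lineMap z w t : ℂ).re = z.re + t * (w.re - z.re) := by
  simp [AffineMap.lineMap_apply, -Complex.real_smul, Complex.smul_re, add_comm]

theorem Complex.lineMap_im (z w : ℂ) (t : ℝ) :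
    (AffineMap.lineMap z w t : ℂ).im = z.im + t * (w.im - z.im) := by
  simp [AffineMap.lineMap_apply, -Complex.real_smul, Complex.smul_im, add_comm]

theorem lineMap_crossing {y : ℝ} {z w : ℂ} (h : w.im - z.im ≠ 0) :
    AffineMap.lineMap z w ((y - z.im) / (w.im - z.im)) = (⟨crossingRe y z w, y⟩ : ℂ) := by
  apply Complex.ext
  · rw [Complex.lineMap_re, crossingRe]
  · rw [Complex.lineMap_im]
    field_simp
    ring

theorem crossing_mem_Ioo {y : ℝ} {z w : ℂ} (hz : z.im ≠ y) (hw : w.im ≠ y)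
    (h : crossingSign y z w ≠ 0) :
    w.im - z.im ≠ 0 ∧ (y - z.im) / (w.im - z.im) ∈ Set.Ioo (0 : ℝ) 1 := by
  unfold crossingSign at h
  rcases lt_or_gt_of_ne hz with hz' | hz' <;> rcases lt_or_gt_of_ne hw with hw' | hw'
  · simp [hz'.le.not_gt, hw'.le.not_gt] at h
  · have : 0 < w.im - z.im := by linarith
    refine ⟨this.ne', ?_, ?_⟩
    · exact div_pos (by linarith) this
    · rw [div_lt_one this]; linarith
  · have : w.im - z.im < 0 := by linarith
    refine ⟨this.ne, ?_, ?_⟩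
    · exact div_pos_of_neg_of_neg (by linarith) this
    · rw [div_lt_one_of_neg this]; linarith
  · simp [hz', hw'] at h

theorem Fin.sum_range_add_ofNat {M : Type*} [AddCommMonoid M] (n : ℕ) [NeZero n] (i : Fin n)
    (F : Fin n → M) : ∑ k ∈ Finset.range n, F (i + Fin.ofNat n k) = ∑ j, F j := by
  rw [Finset.sum_range, ← Equiv.sum_comp (Equiv.addLeft i) F]
  refine Finset.sum_congr rfl fun k _ => ?_
  have : Fin.ofNat n k = k := by ext; simp
  rw [this, Equiv.coe_addLeft]

namespace Polygon

variable {n : ℕ} [NeZero n]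

/-- The sum of the turning angles at all vertices. -/
def totalTurn (P : Polygon ℂ n) : ℝ :=
  ∑ j : Fin n, Complex.arg ((P (j + 1 + 1) - P (j + 1)) / (P (j + 1) - P j))

theorem sum_turn (P : Polygon ℂ n) (i : Fin n) :
    ∑ k ∈ Finset.range n, P.turn i (k + 1) = P.totalTurn := by
  rw [totalTurn, ← Fin.sum_range_add_ofNat n i]
  refine Finset.sum_congr rfl fun k _ => ?_
  simp only [turn, edgeVec_eq, Nat.add_sub_cancel, Fin.ofNat_succ_eq,
    vertexFrom, ← add_assoc]

theorem chainFrom_sub (P : Polygon ℂ n) (i : Fin n) {τ : ℝ} (h0 : 0 < τ) (h1 : τ < 1)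
    {k : ℕ} (hk : k ≤ n) :
    ∃ c : ℝ, 0 < c ∧ P.chainFrom i τ (k + 1) - P.chainFrom i τ k = c * P.edgeVec i k := by
  have hn : 1 ≤ n := Nat.one_le_iff_ne_zero.2 (NeZero.ne n)
  rcases Nat.eq_zero_or_pos k with rfl | hk0
  · refine ⟨1 - τ, by linarith, ?_⟩
    rw [chainFrom_zero, chainFrom_of_mem P i τ le_rfl hn, edgeVec_eq]
    simp only [AffineMap.lineMap_apply, vsub_eq_sub, vadd_eq_add, Complex.real_smul]
    push_cast
    ring
  · rcases hk.lt_or_eq with hk' | rfl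
    · refine ⟨1, one_pos, ?_⟩
      rw [chainFrom_of_mem P i τ hk0 hk, chainFrom_of_mem P i τ (by omega) hk', edgeVec_eq]
      simp
    · refine ⟨τ, h0, ?_⟩
      have e0 := P.vertexFrom_add_self i 0
      have e1 := P.vertexFrom_add_self i 1
      rw [zero_add] at e0
      rw [add_comm] at e1
      rw [chainFrom_succ_self, chainFrom_of_mem P i τ hk0 le_rfl, edgeVec_eq, e0, e1]
      simp only [AffineMap.lineMap_apply, vsub_eq_sub, vadd_eq_add, Complex.real_smul]
      ring

/-- The total turn of a simple polygon is twice the angle it sweeps seen from a point inside one of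
its edges. -/
theorem IsSimple.totalTurn_eq {P : Polygon ℂ n} (h : P.IsSimple) (hn : 2 ≤ n) (i : Fin n) {τ : ℝ}
    (h0 : 0 < τ) (h1 : τ < 1) :
    P.totalTurn = 2 * ∑ l ∈ Finset.range (n - 1),
      Complex.arg
        ((P.vertexFrom i (l + 2) - AffineMap.lineMap (P.vertexFrom i 0) (P.vertexFrom i 1) τ) /
        (P.vertexFrom i (l + 1) - AffineMap.lineMap (P.vertexFrom i 0) (P.vertexFrom i 1) τ)) := by
  obtain ⟨M, hM⟩ := Nat.exists_eq_add_of_le' hn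
  have hchain := h.isSimpleChain_chainFrom i h0 h1
  rw [show n + 1 = M + 3 by omega] at hchain
  have key := hchain.sum_turn_eq (by
    rw [show M + 3 = n + 1 by omega, chainFrom_succ_self, chainFrom_zero])
  rw [← P.sum_turn i]
  -- Inserting the base point only rescales edge vectors by positive factors, so the turns at the
  -- vertices are unchanged.
  have hl : ∑ k ∈ Finset.range n, P.turn i (k + 1) = ∑ k ∈ Finset.range (M + 2),
      Complex.arg ((P.chainFrom i τ (k + 2) - P.chainFrom i τ (k + 1)) /
        (P.chainFrom i τ (k + 1) - P.chainFrom i τ k)) := by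
    refine Finset.sum_congr (by rw [hM]) fun k hk => ?_
    have hk := Finset.mem_range.1 hk
    obtain ⟨c, hc, e⟩ := P.chainFrom_sub i h0 h1 (k := k) (by omega)
    obtain ⟨c', hc', e'⟩ := P.chainFrom_sub i h0 h1 (k := k + 1) (by omega)
    rw [e, e', mul_div_mul_comm, ← Complex.ofReal_div, Complex.arg_real_mul _ (div_pos hc' hc),
      turn, Nat.add_sub_cancel]
  -- The base point lies on the segment between its two neighbours in the chain, so both correction
  -- terms vanish.
  have hb : Complex.arg ((P.chainFrom i τ (M + 2) - P.chainFrom i τ 1) /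
      (P.chainFrom i τ (M + 2) - P.chainFrom i τ 0)) = 0 ∧
      Complex.arg ((P.chainFrom i τ 0 - P.chainFrom i τ 1) /
        (P.chainFrom i τ (M + 2) - P.chainFrom i τ 1)) = 0 := by
    have e0 := P.vertexFrom_add_self i 0
    rw [zero_add] at e0
    rw [← hM, chainFrom_of_mem P i τ le_rfl (by omega), chainFrom_of_mem P i τ (by omega) le_rfl,
      chainFrom_zero, e0]
    set z := P.vertexFrom i 0
    set w := P.vertexFrom i 1
    have a1 : z - (AffineMap.lineMap z w τ : ℂ) = (τ : ℝ) * (z - w) := by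
      simp only [AffineMap.lineMap_apply, vsub_eq_sub, vadd_eq_add, Complex.real_smul]
      ring
    have a2 : (AffineMap.lineMap z w τ : ℂ) - w = ((1 - τ : ℝ) : ℂ) * (z - w) := by
      simp only [AffineMap.lineMap_apply, vsub_eq_sub, vadd_eq_add, Complex.real_smul]
      push_cast
      ring
    rw [a1, a2]
    constructor
    · rw [← one_mul (z - w), ← mul_assoc, mul_div_mul_comm, mul_one, ← Complex.ofReal_one,
        ← Complex.ofReal_div, Complex.arg_real_mul _ (by positivity), Complex.arg_div_self]
    · rw [mul_div_assoc, Complex.arg_real_mul _ (by linarith), Complex.arg_div_self]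
  rw [hl, key, hb.1, hb.2, add_zero, add_zero, chainFrom_zero,
    show n - 1 = M + 1 by omega]
  congr 1
  refine Finset.sum_congr rfl fun l hl => ?_
  have := Finset.mem_range.1 hl
  rw [chainFrom_of_mem P i τ (by omega) (by omega), chainFrom_of_mem P i τ (by omega) (by omega)]

/-- On a level that contains no vertex, the total turn of a simple polygon is determined by an edge
crossing that level and by the edges that cross it further left. -/
theorem IsSimple.totalTurn_eq_of_crossing {P : Polygon ℂ n} (h : P.IsSimple) (hn : 2 ≤ n) {y : ℝ}
    (hy : ∀ j, (P j).im ≠ y) (i : Fin n) (hi : crossingSign y (P i) (P (i + 1)) ≠ 0) :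
    P.totalTurn = -2 * π * (crossingSign y (P i) (P (i + 1)) +
      2 * ∑ j : Fin n, if crossingRe y (P j) (P (j + 1)) < crossingRe y (P i) (P (i + 1)) then
        crossingSign y (P j) (P (j + 1)) else 0) := by
  obtain ⟨hne, hτ⟩ := crossing_mem_Ioo (hy i) (hy (i + 1)) hi
  have hO := lineMap_crossing (y := y) hne
  set τ := (y - (P i).im) / ((P (i + 1)).im - (P i).im) with hτdef
  have p0 := P.vertexFrom_zero i
  have p1 : P.vertexFrom i 1 = P (i + 1) := by
    rw [vertexFrom_succ, show i + Fin.ofNat n 0 = i by ext; simp]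
  have hvy : ∀ k, (P.vertexFrom i k).im ≠ y := fun k => hy _
  have key := h.totalTurn_eq hn i hτ.1 hτ.2
  rw [p0, p1, hO] at key
  set o : ℂ := ⟨crossingRe y (P i) (P (i + 1)), y⟩ with ho
  -- By simplicity no other edge passes through `o`.
  have hdist : ∀ k, 1 ≤ k → k < n →
      crossingSign o.im (P.vertexFrom i k) (P.vertexFrom i (k + 1)) ≠ 0 →
      crossingRe o.im (P.vertexFrom i k) (P.vertexFrom i (k + 1)) ≠ o.re := by
    intro k hk1 hkn hs heq
    obtain ⟨hne', hτ'⟩ := crossing_mem_Ioo (hvy k) (hvy (k + 1)) hs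
    have hO' := lineMap_crossing (y := y) hne'
    change crossingRe y _ _ = crossingRe y _ _ at heq
    rw [heq, ← ho, ← hO, ← p0, ← p1] at hO'
    have := (h.lineMap_injective i (l := 0) ⟨hτ'.1.le, hτ'.2⟩ ⟨hτ.1.le, hτ.2⟩ hO').1
    rw [Nat.modEq_zero_iff_dvd] at this
    have := Nat.le_of_dvd (by omega) this
    omega
  have hterm : ∀ l ∈ Finset.range (n - 1),
      Complex.arg ((P.vertexFrom i (l + 2) - o) / (P.vertexFrom i (l + 1) - o)) =
        (Complex.arg (P.vertexFrom i (l + 1 + 1) - o) - Complex.arg (P.vertexFrom i (l + 1) - o)) -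
        2 * π * (if crossingRe y (P.vertexFrom i (l + 1)) (P.vertexFrom i (l + 1 + 1)) < o.re then
          crossingSign y (P.vertexFrom i (l + 1)) (P.vertexFrom i (l + 1 + 1)) else 0) := by
    intro l hl
    have := Finset.mem_range.1 hl
    exact arg_sub_div_sub_eq (hvy _) (hvy _) (hdist (l + 1) (by omega) (by omega))
  rw [Finset.sum_congr rfl hterm, Finset.sum_sub_distrib,
    Finset.sum_range_sub (fun l => Complex.arg (P.vertexFrom i (l + 1) - o)), ← Finset.mul_sum,
    Nat.sub_add_cancel (by omega), zero_add] at key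
  have e0 := P.vertexFrom_add_self i 0
  rw [zero_add] at e0
  rw [e0, p0, p1] at key
  have hsum : ∑ j : Fin n, (if crossingRe y (P j) (P (j + 1)) < o.re then
        crossingSign y (P j) (P (j + 1)) else 0) =
      ∑ l ∈ Finset.range (n - 1),
        if crossingRe y (P.vertexFrom i (l + 1)) (P.vertexFrom i (l + 1 + 1)) < o.re then
          crossingSign y (P.vertexFrom i (l + 1)) (P.vertexFrom i (l + 1 + 1)) else 0 := by
    have split : ∀ G : ℕ → ℝ, ∑ k ∈ Finset.range n, G k =
        ∑ k ∈ Finset.range (n - 1), G (k + 1) + G 0 := by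
      intro G
      rw [← Finset.sum_range_succ', Nat.sub_add_cancel (by omega)]
    rw [← Fin.sum_range_add_ofNat n i, split, show i + Fin.ofNat n 0 = i by ext; simp,
      if_neg (lt_irrefl _), add_zero]
    simp only [vertexFrom, Fin.ofNat_succ_eq, ← add_assoc]
  have a1 : P i - o = ((τ : ℝ) : ℂ) * -(P (i + 1) - P i) := by
    rw [← hO]
    simp only [AffineMap.lineMap_apply, vsub_eq_sub, vadd_eq_add, Complex.real_smul]
    ring
  have a2 : P (i + 1) - o = ((1 - τ : ℝ) : ℂ) * (P (i + 1) - P i) := by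
    rw [← hO]
    simp only [AffineMap.lineMap_apply, vsub_eq_sub, vadd_eq_add, Complex.real_smul]
    push_cast
    ring
  rw [← hsum, a1, a2, Complex.arg_real_mul _ hτ.1, Complex.arg_real_mul _ (by linarith [hτ.2])]
    at key
  -- After telescoping, only the arguments of the two ends of edge `i` seen from `o` remain. They
  -- are opposite directions, so they contribute `π` up to the sign of the crossing.
  have him : (P (i + 1) - P i).im = (P (i + 1)).im - (P i).im := Complex.sub_im _ _
  have hsign : Complex.arg (-(P (i + 1) - P i)) - Complex.arg (P (i + 1) - P i) =
      -π * crossingSign y (P i) (P (i + 1)) := by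
    have h1 := hτ.1
    rw [hτdef, div_pos_iff] at h1
    have h2 := hτ.2
    rw [hτdef] at h2
    rcases h1 with ⟨h1, h3⟩ | ⟨h1, h3⟩
    · rw [div_lt_one h3] at h2
      rw [Complex.arg_neg_eq_arg_sub_pi_of_im_pos (by rw [him]; exact h3), crossingSign,
        if_pos (by linarith), if_neg (by linarith)]
      ring
    · rw [div_lt_one_of_neg h3] at h2
      rw [Complex.arg_neg_eq_arg_add_pi_of_im_neg (by rw [him]; exact h3), crossingSign,
        if_neg (by linarith), if_pos (by linarith)]
      ring
  rw [key, hsign]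
  ring

end Polygon

/-! ### Area by horizontal slices and the theorem on turning tangents -/

/-- Signs `s i = ±1` attached to distinct points `x i` of the line alternate in the sense that
`s i + 2 ∑_{x j < x i} s j` is a constant `c`, and they sum up to zero: then `c = ±1` and
`∑ s i * x i` has the sign of `-c`. -/
theorem Finset.alternating_sum_mul_nonpos {ι : Type*} [DecidableEq ι] (s x : ι → ℝ) (c : ℝ)
    (N : ℕ) : ∀ F : Finset ι, F.card ≤ N → (∀ i ∈ F, s i = 1 ∨ s i = -1) → Set.InjOn x F →
    ∑ i ∈ F, s i = 0 → (∀ i ∈ F, s i + 2 * ∑ j ∈ F, (if x j < x i then s j else 0) = c) →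
    (F.Nonempty → c = 1 ∨ c = -1) ∧ c * ∑ i ∈ F, s i * x i ≤ 0 := by
  induction N with
  | zero =>
    intro F hF _ _ _ _
    rw [Nat.le_zero, Finset.card_eq_zero] at hF
    simp [hF]
  | succ N ih =>
    intro F hF hs hx h0 hc
    rcases F.eq_empty_or_nonempty with rfl | hne
    · simp
    obtain ⟨a, haF, ha⟩ := F.exists_min_image x hne
    have hsa : s a = c := by
      rw [← hc a haF, Finset.sum_eq_zero]
      · ring
      · intro j hj
        rw [if_neg (ha j hj).not_gt]
    refine ⟨fun _ => by rw [← hsa]; exact hs a haF, ?_⟩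
    have hne' : (F.erase a).Nonempty := by
      rw [Finset.nonempty_iff_ne_empty]
      intro he
      rw [← Finset.add_sum_erase F s haF, he] at h0
      rcases hs a haF with h | h <;> rw [h] at h0 <;> norm_num at h0
    obtain ⟨b, hbF, hb⟩ := (F.erase a).exists_min_image x hne'
    have hbF' := Finset.mem_of_mem_erase hbF
    have hab : x a < x b := lt_of_le_of_ne (ha b hbF')
      fun h => (Finset.ne_of_mem_erase hbF) (hx hbF' haF h.symm)
    -- The leftmost sign is `c`, so the condition at the second point reads `s b + 2 c = c`. The two
    -- signs cancel, and the remaining points satisfy the hypotheses with the same `c`.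
    have hsb : s b = -c := by
      have := hc b hbF'
      rw [← Finset.add_sum_erase F _ haF, if_pos hab, Finset.sum_eq_zero, hsa] at this
      · linarith
      · intro j hj
        rw [if_neg (hb j hj).not_gt]
    set G := (F.erase a).erase b with hG
    have hGF : ∀ j ∈ G, j ∈ F ∧ x b < x j := by
      intro j hj
      have h1 := Finset.mem_of_mem_erase hj
      refine ⟨Finset.mem_of_mem_erase h1, lt_of_le_of_ne (hb j h1) fun h => ?_⟩
      exact (Finset.ne_of_mem_erase hj) (hx (Finset.mem_of_mem_erase h1) hbF' h.symm)
    have hsum : ∀ f : ι → ℝ, ∑ j ∈ F, f j = f a + (f b + ∑ j ∈ G, f j) := by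
      intro f
      rw [← Finset.add_sum_erase F f haF, ← Finset.add_sum_erase _ f hbF]
    have hcard : G.card ≤ N := by
      have h1 := Finset.card_erase_lt_of_mem haF
      have h2 := Finset.card_erase_lt_of_mem hbF
      rw [← hG] at h2
      omega
    have := (ih G hcard (fun i hi => hs i (hGF i hi).1)
      (hx.mono fun j hj => (hGF j hj).1) (by rw [hsum, hsa, hsb] at h0; linarith) (by
        intro i hi
        have h1 := hc i (hGF i hi).1
        have h2 := (hGF i hi).2
        rw [hsum, if_pos (hab.trans h2), if_pos h2, hsa, hsb] at h1
        linarith)).2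
    rw [hsum, hsa, hsb]
    nlinarith [mul_self_nonneg c, mul_nonneg (mul_self_nonneg c) (sub_nonneg.2 hab.le)]

theorem crossingRe_comm {y : ℝ} {z w : ℂ} (h : z.im ≠ w.im) :
    crossingRe y z w = crossingRe y w z := by
  have h1 : w.im - z.im ≠ 0 := sub_ne_zero.2 h.symm
  have h2 : z.im - w.im ≠ 0 := sub_ne_zero.2 h
  unfold crossingRe
  field_simp
  ring

/-- The sign is the indicator of `[z.im, w.im)`, so this is the integral of `x dy` along the
segment. -/
theorem integral_crossing_of_lt {z w : ℂ} (h : z.im < w.im) :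
    MeasureTheory.Integrable (fun y => crossingSign y z w * crossingRe y z w) ∧
    ∫ y, crossingSign y z w * crossingRe y z w = (z.re + w.re) / 2 * (w.im - z.im) := by
  have hD : w.im - z.im ≠ 0 := by linarith
  have hg : (fun y => crossingSign y z w * crossingRe y z w) =
      (Set.Ico z.im w.im).indicator (fun y => crossingRe y z w) := by
    funext y
    by_cases hy : y ∈ Set.Ico z.im w.im
    · rw [Set.indicator_of_mem hy, crossingSign, if_pos hy.2, if_neg hy.1.not_gt]
      ring
    · rw [Set.indicator_of_notMem hy, crossingSign]
      by_cases h1 : y < z.im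
      · rw [if_pos h1, if_pos (h1.trans h)]; ring
      · rw [if_neg h1, if_neg fun h2 => hy ⟨not_lt.1 h1, h2⟩]; ring
  have hlin : ∀ y, crossingRe y z w =
      (z.re - z.im * ((w.re - z.re) / (w.im - z.im))) + (w.re - z.re) / (w.im - z.im) * y := by
    intro y
    unfold crossingRe
    field_simp
    ring
  have hcont : Continuous (fun y => crossingRe y z w) := by
    simp only [hlin]
    fun_prop
  rw [hg]
  constructor
  · rw [MeasureTheory.integrable_indicator_iff measurableSet_Ico]
    exact hcont.integrableOn_Icc.mono_set Set.Ico_subset_Icc_self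
  · rw [MeasureTheory.integral_indicator measurableSet_Ico,
      MeasureTheory.integral_Ico_eq_integral_Ioc, ← intervalIntegral.integral_of_le h.le]
    simp only [hlin]
    rw [intervalIntegral.integral_add (by simp) (Continuous.intervalIntegrable (by fun_prop) _ _),
      intervalIntegral.integral_const_mul, intervalIntegral.integral_const, integral_id,
      smul_eq_mul]
    field_simp
    ring

theorem integral_crossing (z w : ℂ) :
    MeasureTheory.Integrable (fun y => crossingSign y z w * crossingRe y z w) ∧
    ∫ y, crossingSign y z w * crossingRe y z w = (z.re + w.re) / 2 * (w.im - z.im) := by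
  rcases lt_trichotomy z.im w.im with h | h | h
  · exact integral_crossing_of_lt h
  · simp [crossingSign, h]
  · obtain ⟨h1, h2⟩ := integral_crossing_of_lt h
    have : (fun y => crossingSign y z w * crossingRe y z w) =
        fun y => -(crossingSign y w z * crossingRe y w z) := by
      funext y
      rw [crossingRe_comm h.ne', crossingSign, crossingSign]
      ring
    rw [this]
    refine ⟨h1.neg, ?_⟩
    rw [MeasureTheory.integral_neg, h2]
    ring

namespace Polygon

variable {n : ℕ} [NeZero n]

theorem sum_add_one_sub (f : Fin n → ℝ) : ∑ i, (f (i + 1) - f i) = 0 := by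
  rw [Finset.sum_sub_distrib, sub_eq_zero]
  exact Equiv.sum_comp (Equiv.addRight (1 : Fin n)) f

/-- The signed area, computed by horizontal slices. -/
theorem signedArea_eq_integral (P : Polygon ℂ n) :
    P.signedArea = ∫ y, ∑ i, crossingSign y (P i) (P (i + 1)) * crossingRe y (P i) (P (i + 1)) := by
  rw [MeasureTheory.integral_finsetSum _ fun i _ => (integral_crossing _ _).1,
    Finset.sum_congr rfl fun i _ => (integral_crossing (P i) (P (i + 1))).2, signedArea,
    Finset.sum_div]
  -- The integral of `x dy` over an edge exceeds its shoelace term by half the increment of `x y`,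
  -- which sums to zero around the polygon.
  have := sum_add_one_sub (fun i => (P i).re * (P i).im / 2)
  rw [← add_zero (∑ i, _), ← this, ← Finset.sum_add_distrib]
  refine Finset.sum_congr rfl fun i _ => ?_
  ring

theorem IsSimple.sum_crossing_nonpos {P : Polygon ℂ n} (h : P.IsSimple) (hn : 2 ≤ n)
    (hT : P.totalTurn ≠ 2 * π) {y : ℝ} (hy : ∀ j, (P j).im ≠ y) :
    ∑ i, crossingSign y (P i) (P (i + 1)) * crossingRe y (P i) (P (i + 1)) ≤ 0 := by
  classical
  obtain ⟨s, hs⟩ : ∃ s : Fin n → ℝ, ∀ i, s i = crossingSign y (P i) (P (i + 1)) :=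
    ⟨_, fun _ => rfl⟩
  obtain ⟨x, hx⟩ : ∃ x : Fin n → ℝ, ∀ i, x i = crossingRe y (P i) (P (i + 1)) :=
    ⟨_, fun _ => rfl⟩
  have hcross := fun i hi => h.totalTurn_eq_of_crossing hn hy i hi
  have hmem := fun i hi => crossing_mem_Ioo (hy i) (hy (i + 1)) hi
  simp only [← hs, ← hx] at hcross hmem ⊢
  set F : Finset (Fin n) := Finset.univ.filter fun i => s i ≠ 0 with hF
  have hsum : ∀ f : Fin n → ℝ, (∀ i, s i = 0 → f i = 0) → ∑ i ∈ F, f i = ∑ i, f i := by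
    intro f hf
    refine Finset.sum_subset (Finset.subset_univ _) fun i _ hi => hf i ?_
    by_contra hne
    exact hi (by simp [hF, hne])
  have hFs : ∀ i ∈ F, s i ≠ 0 := fun i hi => (Finset.mem_filter.1 hi).2
  -- The constant `c` is read off from `totalTurn_eq_of_crossing`; a total turn other than `2π`
  -- excludes `c = -1`.
  have key := Finset.alternating_sum_mul_nonpos s x (-P.totalTurn / (2 * π)) F.card F le_rfl
    (by
      intro i hi
      have := hFs i hi
      rw [hs, crossingSign] at this ⊢
      revert this
      split_ifs <;> norm_num)
    (by
      intro i hi j hj hij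
      have ei := lineMap_crossing (y := y) (hmem i (hFs i hi)).1
      have ej := lineMap_crossing (y := y) (hmem j (hFs j hj)).1
      rw [← hx] at ei ej
      rw [hij, ← ej] at ei
      have := h (x₁ := (i, _)) (x₂ := (j, _))
        ⟨Set.mem_univ _, (hmem i (hFs i hi)).2.1.le, (hmem i (hFs i hi)).2.2⟩
        ⟨Set.mem_univ _, (hmem j (hFs j hj)).2.1.le, (hmem j (hFs j hj)).2.2⟩
        (by simpa only [edgePath, finRotate_eq_add_one] using ei)
      exact (Prod.mk.inj this).1)
    (by
      rw [hsum s fun _ h => h]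
      simp only [hs, crossingSign]
      exact sum_add_one_sub fun i => if y < (P i).im then (1 : ℝ) else 0)
    (by
      intro i hi
      rw [hsum _ fun j hj => by simp [hj], hcross i (hFs i hi)]
      field_simp [Real.pi_ne_zero])
  rw [hsum (fun i => s i * x i) fun j hj => by simp [hj]] at key
  rcases F.eq_empty_or_nonempty with he | hne
  · refine le_of_eq ?_
    rw [← hsum (fun i => s i * x i) fun j hj => by simp [hj], he, Finset.sum_empty]
  · rcases key.1 hne with h1 | h1
    · rw [h1, one_mul] at key
      exact key.2
    · refine absurd ?_ hT
      rw [div_eq_iff Real.two_pi_pos.ne'] at h1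
      linarith

/-- **Theorem on turning tangents** for polygons: a simple polygon whose vertices are listed in
counterclockwise order turns by `2 π` in total. -/
theorem IsSimple.totalTurn_eq_two_pi {P : Polygon ℂ n} (h : P.IsSimple)
    (hP : P.IsCounterclockwise) (hn : 2 ≤ n) : P.totalTurn = 2 * π := by
  by_contra hT
  have hfin : (Set.range fun j => (P j).im).Finite := Set.finite_range _
  have hae : ∀ᵐ y : ℝ, ∀ j, (P j).im ≠ y := by
    filter_upwards [MeasureTheory.compl_mem_ae_iff.2 (hfin.measure_zero MeasureTheory.volume)]
      with y hy j hj
    exact hy ⟨j, hj⟩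
  have : P.signedArea ≤ 0 := by
    rw [signedArea_eq_integral]
    refine MeasureTheory.integral_nonpos_of_ae ?_
    filter_upwards [hae] with y hy
    exact h.sum_crossing_nonpos hn hT hy
  exact absurd hP this.not_gt

end Polygon

/-! ### The upper bound for the span -/

theorem isSpan_exists_of_finite {f : ℝ → ℝ} (h : (f '' Set.Icc 0 1).Finite) :
    ∃ d, IsSpan f d := by
  have hne : (f '' Set.Icc 0 1).Nonempty := (Set.nonempty_Icc.2 zero_le_one).image f
  obtain ⟨M, hM⟩ := h.isCompact.exists_isGreatest hne
  obtain ⟨μ, hμ⟩ := h.isCompact.exists_isLeast hne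
  exact ⟨M - μ, M, μ, hM, hμ, rfl⟩

theorem IsSpan.sub_le {f : ℝ → ℝ} {d : ℝ} (h : IsSpan f d) {x y : ℝ} (hx : x ∈ Set.Icc (0 : ℝ) 1)
    (hy : y ∈ Set.Icc (0 : ℝ) 1) : f x - f y ≤ d := by
  obtain ⟨M, μ, hM, hμ, rfl⟩ := h
  linarith [hM.2 ⟨x, hx, rfl⟩, hμ.2 ⟨y, hy, rfl⟩]

namespace Polygon

variable {n : ℕ} [NeZero n]

theorem IsSimple.edgeVec_ne_zero {P : Polygon ℂ n} (h : P.IsSimple) (i : Fin n) (k : ℕ) :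
    P.edgeVec i k ≠ 0 := by
  rw [edgeVec_eq, sub_ne_zero]
  intro heq
  have := (h.lineMap_injective i (k := k) (l := k) (s := 0) (t := 1 / 2) (by norm_num)
    (by norm_num) (by rw [heq]; simp)).2
  norm_num at this

theorem IsSimple.arcLength_strictMono {P : Polygon ℂ n} (h : P.IsSimple) (i : Fin n) :
    StrictMono (P.arcLength i) := by
  refine strictMono_nat_of_lt_succ fun k => ?_
  rw [arcLength, arcLength, Finset.sum_range_succ]
  linarith [norm_pos_iff.2 (h.edgeVec_ne_zero i k)]

theorem arcLength_self (P : Polygon ℂ n) (i : Fin n) : P.arcLength i n = P.perimeter := by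
  rw [arcLength, perimeter, ← Fin.sum_range_add_ofNat n i]
  simp only [edgeVec, Fin.ofNat_succ_eq, add_assoc]

/-- Arc length increases with `k`, so the vertices already passed form an initial segment. -/
theorem IsSimple.turningFunction_eq {P : Polygon ℂ n} (h : P.IsSimple) (i : Fin n) (τ x : ℝ) :
    ∃ K ≤ n, P.turningFunction i τ x =
      toIcoMod Real.two_pi_pos 0 (Complex.arg (P.edgeVec i 0)) +
        ∑ k ∈ Finset.range K, P.turn i (k + 1) := by
  classical
  set C : ℕ → Prop := fun k => P.arcLength i k ≤ τ * ‖P.edgeVec i 0‖ + x * P.perimeter ∧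
    P.arcLength i k < τ * ‖P.edgeVec i 0‖ + P.perimeter with hC
  refine ⟨Nat.findGreatest C n, Nat.findGreatest_le n, ?_⟩
  rw [turningFunction]
  congr 1
  rw [Finset.range_eq_Ico, Finset.sum_Ico_add' (fun k => P.turn i k) 0 _ 1]
  refine Finset.sum_congr ?_ fun _ _ => rfl
  ext k
  simp only [Finset.mem_filter, Finset.mem_Icc, Finset.mem_Ico]
  constructor
  · rintro ⟨⟨h1, h2⟩, h3⟩
    exact ⟨by omega, Nat.lt_succ_of_le (Nat.le_findGreatest h2 h3)⟩
  · rintro ⟨h1, h2⟩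
    have hspec : C (Nat.findGreatest C n) := Nat.findGreatest_of_ne_zero rfl (by omega)
    have hle := Nat.findGreatest_le (P := C) n
    have hmono := (h.arcLength_strictMono i).monotone (show k ≤ Nat.findGreatest C n by omega)
    exact ⟨⟨by omega, by omega⟩, hmono.trans hspec.1, hmono.trans_lt hspec.2⟩

theorem IsSimple.exists_isSpan {P : Polygon ℂ n} (h : P.IsSimple) (i : Fin n) (τ : ℝ) :
    ∃ d, IsSpan (P.turningFunction i τ) d := by
  refine isSpan_exists_of_finite (((Finset.range (n + 1)).finite_toSet.image fun K =>
    toIcoMod Real.two_pi_pos 0 (Complex.arg (P.edgeVec i 0)) +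
      ∑ k ∈ Finset.range K, P.turn i (k + 1)).subset ?_)
  rintro _ ⟨x, _, rfl⟩
  obtain ⟨K, hK, e⟩ := h.turningFunction_eq i τ x
  exact ⟨K, by simpa using Nat.lt_succ_of_le hK, e.symm⟩

theorem IsSimple.turningFunction_arcLength {P : Polygon ℂ n} (h : P.IsSimple) (i : Fin n) {K : ℕ}
    (hK : K < n) : P.turningFunction i 0 (P.arcLength i K / P.perimeter) =
      toIcoMod Real.two_pi_pos 0 (Complex.arg (P.edgeVec i 0)) +
        ∑ k ∈ Finset.range K, P.turn i (k + 1) := by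
  have hmono := h.arcLength_strictMono i
  have hper : 0 < P.perimeter := by
    have := hmono (Nat.pos_of_ne_zero (NeZero.ne n))
    rwa [arcLength_self, arcLength, Finset.sum_range_zero] at this
  rw [turningFunction]
  congr 1
  rw [Finset.range_eq_Ico, Finset.sum_Ico_add' (fun k => P.turn i k) 0 _ 1]
  refine Finset.sum_congr ?_ fun _ _ => rfl
  ext k
  rw [Finset.mem_filter, Finset.mem_Icc, Finset.mem_Ico, zero_mul, zero_add, zero_add,
    div_mul_cancel₀ _ hper.ne', hmono.le_iff_le, ← P.arcLength_self i, hmono.lt_iff_lt]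
  omega

theorem IsSimple.arcLength_div_mem_Icc {P : Polygon ℂ n} (h : P.IsSimple) (i : Fin n) {K : ℕ}
    (hK : K ≤ n) : P.arcLength i K / P.perimeter ∈ Set.Icc (0 : ℝ) 1 := by
  have hmono := (h.arcLength_strictMono i).monotone
  have h0 : 0 ≤ P.arcLength i K := Finset.sum_nonneg fun _ _ => norm_nonneg _
  rw [← P.arcLength_self i]
  exact ⟨div_nonneg h0 (h0.trans (hmono hK)), div_le_one_of_le₀ (hmono hK) (h0.trans (hmono hK))⟩

theorem abs_sum_turn_le (P : Polygon ℂ n) (i : Fin n) {a b : ℕ} (hab : a ≤ b) :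
    |∑ k ∈ Finset.range b, P.turn i (k + 1) - ∑ k ∈ Finset.range a, P.turn i (k + 1)| ≤
      ((b : ℝ) - a) * π := by
  rw [← Finset.sum_Ico_eq_sub _ hab]
  refine (Finset.abs_sum_le_sum_abs _ _).trans ?_
  refine (Finset.sum_le_card_nsmul _ _ π fun k _ => Complex.abs_arg_le_pi _).trans_eq ?_
  rw [Nat.card_Ico, nsmul_eq_mul, Nat.cast_sub hab]

theorem IsSimple.span_le {P : Polygon ℂ n} (h : P.IsSimple) (hP : P.IsCounterclockwise)
    (hn : 2 ≤ n) (i : Fin n) (τ : ℝ) {d : ℝ} (hd : IsSpan (P.turningFunction i τ) d) :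
    d ≤ (((n / 2 : ℕ) : ℝ) + 1) * π := by
  obtain ⟨M, μ, ⟨⟨x, -, rfl⟩, -⟩, ⟨⟨y, -, rfl⟩, -⟩, rfl⟩ := hd
  obtain ⟨a, ha, ea⟩ := h.turningFunction_eq i τ x
  obtain ⟨b, hb, eb⟩ := h.turningFunction_eq i τ y
  rw [ea, eb]
  have hT := h.totalTurn_eq_two_pi hP hn
  rw [← P.sum_turn i] at hT
  have bound : ∀ k : ℕ, k ≤ n / 2 + 1 → (k : ℝ) * π ≤ (((n / 2 : ℕ) : ℝ) + 1) * π := by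
    intro k hk
    refine mul_le_mul_of_nonneg_right ?_ Real.pi_pos.le
    exact_mod_cast hk
  rcases le_total b a with hab | hab
  · have h1 := abs_le.1 (P.abs_sum_turn_le i hab)
    have h2 := abs_le.1 (P.abs_sum_turn_le i ha)
    have h3 := abs_le.1 (P.abs_sum_turn_le i (Nat.zero_le b))
    rw [Finset.sum_range_zero] at h3
    push_cast at h3
    by_cases hk : a - b ≤ n / 2 + 1
    · have := bound _ hk
      rw [Nat.cast_sub hab] at this
      linarith [h1.2]
    -- The block from `b` to `a` is too long, so it is estimated as `2π` minus its complement of `n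
    -- - (a - b)` turns.
    · have := bound (n + 2 + b - a) (by omega)
      rw [Nat.cast_sub (by omega)] at this
      push_cast at this
      linarith [h2.1, h3.1]
  · have h1 := abs_le.1 (P.abs_sum_turn_le i hab)
    have h2 := abs_le.1 (P.abs_sum_turn_le i hb)
    have h3 := abs_le.1 (P.abs_sum_turn_le i (Nat.zero_le a))
    rw [Finset.sum_range_zero] at h3
    push_cast at h3
    by_cases hk : b - a ≤ n / 2 + 1
    · have := bound _ hk
      rw [Nat.cast_sub hab] at this
      linarith [h1.1]
    -- Here the difference is minus the sum of a block, so the total `2π` enters with a negative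
    -- sign and can be dropped.
    · have := bound (n + a - b) (by omega)
      rw [Nat.cast_sub (by omega)] at this
      push_cast at this
      linarith [h2.2, h3.2, Real.pi_pos]

end Polygon

/-! ### Orientation tests for disjoint segments -/

/-- The cross product of two plane vectors. -/
def planeCross (a b : ℂ) : ℝ := a.re * b.im - a.im * b.re

/-- Twice the signed area of the triangle `a b c`. -/
def orientation (a b c : ℂ) : ℝ := planeCross (b - a) (c - b)

theorem orientation_swap (a b c : ℂ) : orientation b a c = -orientation a b c := by
  simp only [orientation, planeCross, Complex.sub_re, Complex.sub_im]; ring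

theorem orientation_rotate (a b c : ℂ) : orientation b c a = orientation a b c := by
  simp only [orientation, planeCross, Complex.sub_re, Complex.sub_im]; ring

theorem orientation_lineMap (a b c d : ℂ) (t : ℝ) :
    orientation a b (AffineMap.lineMap c d t) =
      (1 - t) * orientation a b c + t * orientation a b d := by
  simp only [orientation, planeCross, Complex.sub_re, Complex.sub_im, Complex.lineMap_re,
    Complex.lineMap_im]
  ring

theorem orientation_left (a b : ℂ) : orientation a b a = 0 := by
  simp only [orientation, planeCross, Complex.sub_re, Complex.sub_im]; ring

theorem orientation_right (a b : ℂ) : orientation a b b = 0 := by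
  simp only [orientation, planeCross, Complex.sub_re, Complex.sub_im]; ring

/-- The half-open segments `[a, b)` and `[c, d)` are disjoint if `[c, d)` lies strictly on one side
of the line `a b`, possibly apart from a common point `c = b`. -/
theorem lineMap_ne_of_orientation {a b c d : ℂ} (σ : ℝ)
    (h : (0 < σ * orientation a b c ∧ 0 ≤ σ * orientation a b d) ∨
      (c = b ∧ 0 < σ * orientation a b d)) {s t : ℝ} (hs : s ∈ Set.Ico (0 : ℝ) 1)
    (ht : t ∈ Set.Ico (0 : ℝ) 1) :
    (AffineMap.lineMap a b s : ℂ) ≠ AffineMap.lineMap c d t := by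
  intro heq
  have h1 := orientation_lineMap a b a b s
  rw [heq, orientation_lineMap, orientation_left, orientation_right] at h1
  rcases h with ⟨h2, h3⟩ | ⟨rfl, h3⟩
  · have := mul_pos (show 0 < 1 - t by linarith [ht.2]) h2
    have := mul_nonneg ht.1 h3
    have : σ * ((1 - t) * orientation a b c + t * orientation a b d) = 0 := by rw [h1]; ring
    linarith
  · rw [orientation_right] at h1
    have hd : orientation a c d ≠ 0 := fun h => by rw [h] at h3; simp at h3
    have ht0 : t = 0 := by
      have : t * orientation a c d = 0 := by linarith
      exact (mul_eq_zero.1 this).resolve_right hd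
    have hac : a ≠ c := by
      rintro rfl
      apply hd
      simp [orientation, planeCross]
    rw [ht0, AffineMap.lineMap_apply_zero] at heq
    have : ((1 - s : ℝ) : ℂ) * (c - a) = 0 := by
      simp only [AffineMap.lineMap_apply, vsub_eq_sub, vadd_eq_add, Complex.real_smul] at heq
      push_cast
      linear_combination -heq
    rcases mul_eq_zero.1 this with h | h
    · have : 1 - s = 0 := by exact_mod_cast h
      linarith [hs.2]
    · exact hac (sub_eq_zero.1 h).symm

theorem affineIndependent_of_orientation {a b c : ℂ} (h : orientation a b c ≠ 0) :
    AffineIndependent ℝ ![a, b, c] := by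
  rw [affineIndependent_iff_not_collinear_set]
  intro hcol
  obtain ⟨v, hv⟩ := (collinear_iff_of_mem (p₀ := a) (by simp)).1 hcol
  obtain ⟨r, hr⟩ := hv b (by simp)
  obtain ⟨t, ht⟩ := hv c (by simp)
  apply h
  rw [hr, ht]
  simp [orientation, planeCross]
  ring

/-! ### The spiral and the band along it -/

/-- The points of a spiral around the origin, flattened in the vertical direction. -/
def spiralPoint (δ : ℝ) (j : ℕ) : ℂ := ⟨(-4) ^ j, δ * (-2) ^ j⟩

theorem orientation_spiralPoint_smul (δ s t r : ℝ) (i j k : ℕ) :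
    orientation (s • spiralPoint δ i) (t • spiralPoint δ j) (r • spiralPoint δ k) =
      δ * (s * t * ((-4) ^ i * (-2) ^ j - (-2) ^ i * (-4) ^ j) +
        t * r * ((-4) ^ j * (-2) ^ k - (-2) ^ j * (-4) ^ k) -
        s * r * ((-4) ^ i * (-2) ^ k - (-2) ^ i * (-4) ^ k)) := by
  simp only [orientation, planeCross, spiralPoint, Complex.sub_re, Complex.sub_im,
    Complex.smul_re, Complex.smul_im, smul_eq_mul]
  ring

theorem neg_four_pow_mul_neg_two_pow (i : ℕ) : (-4 : ℝ) ^ i * (-2) ^ i = 8 ^ i := by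
  rw [← mul_pow]; norm_num

/-- Earlier points of the spiral, slightly shrunk or not, lie to the left of an edge. -/
theorem orientation_spiralPoint_pos {δ s t r : ℝ} (hδ : 0 < δ) (hs : s ∈ Set.Icc (9 / 10 : ℝ) 1)
    (ht : t ∈ Set.Icc (9 / 10 : ℝ) 1) (hr : r ∈ Set.Icc (9 / 10 : ℝ) 1) {i k : ℕ} (hik : i < k) :
    0 < orientation (s • spiralPoint δ k) (t • spiralPoint δ (k + 1)) (r • spiralPoint δ i) := by
  obtain ⟨d, rfl⟩ := Nat.exists_eq_add_of_lt hik
  rw [orientation_spiralPoint_smul]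
  refine mul_pos hδ ?_
  set p : ℝ := 2 ^ d with hp
  have hp1 : 1 ≤ p := one_le_pow₀ (by norm_num)
  have h8 : (0 : ℝ) < 8 ^ i := by positivity
  obtain ⟨hs0, hs1⟩ := hs
  obtain ⟨ht0, ht1⟩ := ht
  obtain ⟨hr0, hr1⟩ := hr
  obtain ⟨e, he, he'⟩ : ∃ e : ℝ, (e = 1 ∨ e = -1) ∧ (-1 : ℝ) ^ d = e :=
    ⟨_, neg_one_pow_eq_or ℝ d, rfl⟩
  have h4 : (-4 : ℝ) ^ d = e * p ^ 2 := by
    rw [hp, ← he', ← pow_mul, mul_comm d 2, pow_mul, ← mul_pow]; norm_num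
  have h2 : (-2 : ℝ) ^ d = e * p := by
    rw [hp, ← he', ← mul_pow]; norm_num
  have hAB := neg_four_pow_mul_neg_two_pow i
  -- With `p = 2 ^ d`, the cubic term comes from the two ends of the edge, and the rest involves the
  -- point of index `i`, with sign `e`.
  have key : s * t * ((-4) ^ (i + d + 1) * (-2) ^ (i + d + 1 + 1) -
        (-2) ^ (i + d + 1) * (-4) ^ (i + d + 1 + 1)) +
      t * r * ((-4) ^ (i + d + 1 + 1) * (-2) ^ i - (-2) ^ (i + d + 1 + 1) * (-4) ^ i) -
      s * r * ((-4) ^ (i + d + 1) * (-2) ^ i - (-2) ^ (i + d + 1) * (-4) ^ i) =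
      8 ^ i * (16 * (s * t) * (e * e) * p ^ 3 + e * (t * r * (16 * p ^ 2 - 4 * p) +
        s * r * (4 * p ^ 2 - 2 * p))) := by
    simp only [pow_add, pow_one, h4, h2]
    rw [← hAB]
    ring
  rw [key]
  refine mul_pos h8 ?_
  have hst : 81 / 100 ≤ s * t := by nlinarith
  have htr : t * r ≤ 1 := by nlinarith
  have hsr : s * r ≤ 1 := by nlinarith
  have htr0 : 0 ≤ t * r := by nlinarith
  have hsr0 : 0 ≤ s * r := by nlinarith
  have q1 : 0 ≤ 16 * p ^ 2 - 4 * p := by nlinarith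
  have q2 : 0 ≤ 4 * p ^ 2 - 2 * p := by nlinarith
  have hp3 : 0 < p ^ 3 := by positivity
  have b1 : 81 / 100 * p ^ 3 ≤ s * t * p ^ 3 := mul_le_mul_of_nonneg_right hst hp3.le
  have b2 := mul_nonneg htr0 q1
  have b3 := mul_nonneg hsr0 q2
  have b4 := mul_le_mul_of_nonneg_right htr q1
  have b5 := mul_le_mul_of_nonneg_right hsr q2
  -- For `p = 1` the cubic bound `12.96` does not beat `14`, but then `e = 1` and nothing is
  -- subtracted. For `p ≥ 2` the cubic dominates whatever the sign.
  rcases Nat.eq_zero_or_pos d with h0 | h0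
  · have he1 : e = 1 := by rw [← he', h0]; norm_num
    rw [he1]
    linarith
  · have hp2 : 2 ≤ p := by
      calc (2 : ℝ) = 2 ^ 1 := (pow_one _).symm
        _ ≤ p := pow_le_pow_right₀ (by norm_num) h0
    have b6 : 20 * p ^ 2 - 6 * p < 16 * (81 / 100) * p ^ 3 := by nlinarith [sq_nonneg (p - 2)]
    rcases he with rfl | rfl <;> linarith

/-- The line through an edge of the spiral has the shrunk spiral up to the next edge to its left. -/
theorem orientation_spiralPoint_shrink_pos {δ : ℝ} (hδ : 0 < δ) {i k : ℕ} (hik : i ≤ k + 2) :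
    0 < orientation (spiralPoint δ k) (spiralPoint δ (k + 1)) ((9 / 10 : ℝ) • spiralPoint δ i) := by
  have h8 : (0 : ℝ) < 8 ^ k := by positivity
  have hAB := neg_four_pow_mul_neg_two_pow k
  rcases lt_or_ge i k with h | h
  · have := orientation_spiralPoint_pos hδ (s := 1) (t := 1) (r := 9 / 10) (by norm_num)
      (by norm_num) (by norm_num) h
    simpa only [one_smul] using this
  · have := orientation_spiralPoint_smul δ 1 1 (9 / 10) k (k + 1) i
    rw [one_smul, one_smul] at this
    rw [this]
    refine mul_pos hδ ?_
    obtain rfl | rfl | rfl : i = k ∨ i = k + 1 ∨ i = k + 2 := by omega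
    all_goals
      simp only [pow_add, pow_one]
      nlinarith

theorem orientation_spiralPoint_next_pos {δ : ℝ} (hδ : 0 < δ) (k : ℕ) :
    0 < orientation (spiralPoint δ k) (spiralPoint δ (k + 1)) (spiralPoint δ (k + 2)) := by
  have h8 : (0 : ℝ) < 8 ^ k := by positivity
  have hAB := neg_four_pow_mul_neg_two_pow k
  have := orientation_spiralPoint_smul δ 1 1 1 k (k + 1) (k + 2)
  rw [one_smul, one_smul, one_smul] at this
  rw [this]
  refine mul_pos hδ ?_
  simp only [pow_add, pow_one]
  nlinarith

/-- The orientation of the small triangle at the inner end of the spiral band. -/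
theorem orientation_spiralPoint_tip {δ : ℝ} (hδ : 0 < δ) {t : ℝ}
    (ht : t ∈ Set.Icc (9 / 10 : ℝ) 1) :
    0 < orientation (t • spiralPoint δ 1) ((9 / 10 : ℝ) • spiralPoint δ 0) (spiralPoint δ 0) := by
  have := orientation_spiralPoint_smul δ t (9 / 10) 1 1 0 0
  rw [one_smul] at this
  rw [this]
  refine mul_pos hδ ?_
  obtain ⟨h1, h2⟩ := ht
  norm_num
  linarith

/-- The vertices of a thin band along the first `h` edges of the spiral with a single vertex at its
outer end, listed cyclically with period `m`. The band has one vertex at its inner end if `m = 2 h`,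
and two if `m = 2 h + 1`. -/
def bandVertex (δ : ℝ) (h m l : ℕ) : ℂ :=
  if l ≤ h then spiralPoint δ l
  else if l < m then (9 / 10 : ℝ) • spiralPoint δ (2 * h - l)
  else spiralPoint δ (l - m)

theorem bandVertex_outer (δ : ℝ) {h m l : ℕ} (hl : l ≤ h) :
    bandVertex δ h m l = spiralPoint δ l := if_pos hl

theorem bandVertex_inner (δ : ℝ) {h m l j : ℕ} (hl : h < l) (hm : l < m) (hj : 2 * h - l = j) :
    bandVertex δ h m l = (9 / 10 : ℝ) • spiralPoint δ j := by
  rw [bandVertex, if_neg hl.not_ge, if_pos hm, hj]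

theorem bandVertex_add (δ : ℝ) {h m l j : ℕ} (hh : h < m) (hl : l = m + j) :
    bandVertex δ h m l = spiralPoint δ j := by
  rw [bandVertex, if_neg (by omega), if_neg (by omega), hl, Nat.add_sub_cancel_left]

section

variable {δ : ℝ} {h m : ℕ}

theorem orientation_shrink_shrink_neg (hδ : 0 < δ) {i k : ℕ} (hik : i < k) :
    0 < -1 * orientation ((9 / 10 : ℝ) • spiralPoint δ (k + 1)) ((9 / 10 : ℝ) • spiralPoint δ k)
      ((9 / 10 : ℝ) • spiralPoint δ i) := by
  rw [orientation_swap, neg_one_mul, neg_neg]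
  exact orientation_spiralPoint_pos hδ (by norm_num) (by norm_num) (by norm_num) hik

theorem orientation_shrink_outer_neg (hδ : 0 < δ) {i k : ℕ} (hik : i < k) :
    0 < -1 * orientation ((9 / 10 : ℝ) • spiralPoint δ (k + 1)) ((9 / 10 : ℝ) • spiralPoint δ k)
      (spiralPoint δ i) := by
  rw [orientation_swap, neg_one_mul, neg_neg]
  have := orientation_spiralPoint_pos hδ (s := 9 / 10) (t := 9 / 10) (r := 1) (by norm_num)
    (by norm_num) (by norm_num) hik
  simpa only [one_smul] using this

theorem orientation_cap_shrink_neg (hδ : 0 < δ) {i k : ℕ} (hik : i < k) :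
    0 < -1 * orientation (spiralPoint δ (k + 1)) ((9 / 10 : ℝ) • spiralPoint δ k)
      ((9 / 10 : ℝ) • spiralPoint δ i) := by
  rw [orientation_swap, neg_one_mul, neg_neg]
  have := orientation_spiralPoint_pos hδ (s := 9 / 10) (t := 1) (r := 9 / 10) (by norm_num)
    (by norm_num) (by norm_num) hik
  simpa only [one_smul] using this

theorem orientation_cap_outer_neg (hδ : 0 < δ) {i k : ℕ} (hik : i < k) :
    0 < -1 * orientation (spiralPoint δ (k + 1)) ((9 / 10 : ℝ) • spiralPoint δ k)
      (spiralPoint δ i) := by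
  rw [orientation_swap, neg_one_mul, neg_neg]
  have := orientation_spiralPoint_pos hδ (s := 9 / 10) (t := 1) (r := 1) (by norm_num)
    (by norm_num) (by norm_num) hik
  simpa only [one_smul] using this

theorem orientation_outer_pos (hδ : 0 < δ) {i k : ℕ} (hik : i < k) :
    0 < orientation (spiralPoint δ k) (spiralPoint δ (k + 1)) (spiralPoint δ i) := by
  have := orientation_spiralPoint_pos hδ (s := 1) (t := 1) (r := 1) (by norm_num)
    (by norm_num) (by norm_num) hik
  simpa only [one_smul] using this

/-- Two distinct edges of the band, consecutive or not, are disjoint as half-open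
segments. -/
theorem lineMap_bandVertex_ne (hδ : 0 < δ) (hm : m = 2 * h ∨ m = 2 * h + 1) (h3 : 3 ≤ m)
    {l l' : ℕ} (hl : l < l') (hl' : l' < m) {s t : ℝ} (hs : s ∈ Set.Ico (0 : ℝ) 1)
    (ht : t ∈ Set.Ico (0 : ℝ) 1) :
    (AffineMap.lineMap (bandVertex δ h m l) (bandVertex δ h m (l + 1)) s : ℂ) ≠
      AffineMap.lineMap (bandVertex δ h m l') (bandVertex δ h m (l' + 1)) t := by
  -- Apart from the tip, the separating line is that of the edge further out, which has all points
  -- of smaller index on the side of the origin, or that of an outer edge `k`, which has on that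
  -- side the point `k + 2` and shrunk points of index up to `k + 2`.
  have hcases : l' < h ∨ l' = h ∨ (h < l' ∧ l' + 1 < m) ∨ (h < l' ∧ l' + 1 = m) := by omega
  have hcases' : l < h ∨ l = h ∨ h < l := by omega
  rcases hcases with c | c | c | c
  · rw [bandVertex_outer δ (by omega : l ≤ h), bandVertex_outer δ (by omega : l + 1 ≤ h),
      bandVertex_outer δ (by omega : l' ≤ h), bandVertex_outer δ (by omega : l' + 1 ≤ h)]
    refine (lineMap_ne_of_orientation 1 (Or.inl ⟨?_, ?_⟩) ht hs).symm
    · rw [one_mul]; exact orientation_outer_pos hδ hl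
    · rw [one_mul]
      rcases (show l + 1 ≤ l' from hl).lt_or_eq with e | e
      · exact (orientation_outer_pos hδ e).le
      · rw [e, orientation_left]
  · obtain ⟨g, rfl⟩ : ∃ g, h = g + 1 := ⟨h - 1, by omega⟩
    subst c
    rw [bandVertex_outer δ (by omega : l ≤ g + 1), bandVertex_outer δ (by omega : l + 1 ≤ g + 1),
      bandVertex_outer δ (le_refl (g + 1)),
      bandVertex_inner δ (j := g) (by omega : g + 1 < g + 1 + 1) (by omega) (by omega)]
    rcases (show l = g ∨ l + 1 = g ∨ l + 1 < g by omega) with e | e | e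
    · rw [e]
      refine lineMap_ne_of_orientation 1 (Or.inr ⟨rfl, ?_⟩) hs ht
      rw [one_mul]
      exact orientation_spiralPoint_shrink_pos hδ (by omega)
    · rw [← e]
      refine lineMap_ne_of_orientation 1 (Or.inl ⟨?_, ?_⟩) hs ht
      · rw [one_mul]
        exact orientation_spiralPoint_next_pos hδ l
      · rw [one_mul]
        exact (orientation_spiralPoint_shrink_pos hδ (by omega)).le
    · refine (lineMap_ne_of_orientation (-1) (Or.inl ⟨?_, ?_⟩) ht hs).symm
      · exact orientation_cap_outer_neg hδ (by omega)
      · exact (orientation_cap_outer_neg hδ e).le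
  · obtain ⟨j, hj⟩ : ∃ j, 2 * h - l' = j + 1 := ⟨2 * h - l' - 1, by omega⟩
    rw [bandVertex_inner δ c.1 (by omega) hj,
      bandVertex_inner δ (j := j) (by omega : h < l' + 1) c.2 (by omega)]
    rcases hcases' with e | e | e
    · rw [bandVertex_outer δ (by omega : l ≤ h), bandVertex_outer δ (by omega : l + 1 ≤ h)]
      rcases le_or_gt j (l + 1) with f | f
      · refine lineMap_ne_of_orientation 1 (Or.inl ⟨?_, ?_⟩) hs ht
        · rw [one_mul]
          exact orientation_spiralPoint_shrink_pos hδ (by omega)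
        · rw [one_mul]
          exact (orientation_spiralPoint_shrink_pos hδ (by omega)).le
      · refine (lineMap_ne_of_orientation (-1) (Or.inl ⟨?_, ?_⟩) ht hs).symm
        · exact orientation_shrink_outer_neg hδ (by omega)
        · exact (orientation_shrink_outer_neg hδ f).le
    · obtain ⟨g, rfl⟩ : ∃ g, h = g + 1 := ⟨h - 1, by omega⟩
      subst e
      rw [bandVertex_outer δ (le_refl (g + 1)),
        bandVertex_inner δ (j := g) (by omega : g + 1 < g + 1 + 1) (by omega) (by omega)]
      rcases (show j + 1 = g ∨ j + 1 < g by omega) with f | f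
      · refine lineMap_ne_of_orientation (-1) (Or.inr ⟨by rw [f], ?_⟩) hs ht
        exact orientation_cap_shrink_neg hδ (by omega)
      · refine lineMap_ne_of_orientation (-1) (Or.inl ⟨?_, ?_⟩) hs ht
        · exact orientation_cap_shrink_neg hδ f
        · exact (orientation_cap_shrink_neg hδ (by omega)).le
    · obtain ⟨J, hJ⟩ : ∃ J, 2 * h - l = J + 1 := ⟨2 * h - l - 1, by omega⟩
      rw [bandVertex_inner δ e (by omega) hJ,
        bandVertex_inner δ (j := J) (by omega : h < l + 1) (by omega) (by omega)]
      rcases (show j + 1 = J ∨ j + 1 < J by omega) with f | f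
      · refine lineMap_ne_of_orientation (-1) (Or.inr ⟨by rw [f], ?_⟩) hs ht
        exact orientation_shrink_shrink_neg hδ (by omega)
      · refine lineMap_ne_of_orientation (-1) (Or.inl ⟨?_, ?_⟩) hs ht
        · exact orientation_shrink_shrink_neg hδ f
        · exact (orientation_shrink_shrink_neg hδ (by omega)).le
  · obtain ⟨q, hq⟩ : ∃ q, 2 * h - l' = q := ⟨_, rfl⟩
    rw [bandVertex_inner δ c.1 (by omega) hq,
      bandVertex_add δ (j := 0) (by omega : h < m) (by omega : l' + 1 = m + 0)]
    rcases hcases' with e | e | e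
    · rw [bandVertex_outer δ (by omega : l ≤ h), bandVertex_outer δ (by omega : l + 1 ≤ h)]
      refine lineMap_ne_of_orientation 1 (Or.inl ⟨?_, ?_⟩) hs ht
      · rw [one_mul]
        exact orientation_spiralPoint_shrink_pos hδ (by omega)
      · rw [one_mul]
        rcases Nat.eq_zero_or_pos l with f | f
        · rw [f, orientation_left]
        · exact (orientation_outer_pos hδ f).le
    · obtain ⟨g, rfl⟩ : ∃ g, h = g + 1 := ⟨h - 1, by omega⟩
      subst e
      rw [bandVertex_outer δ (le_refl (g + 1)),
        bandVertex_inner δ (j := g) (by omega : g + 1 < g + 1 + 1) (by omega) (by omega)]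
      rcases (show q < g ∨ (q = g ∧ 0 < g) ∨ (q = 0 ∧ g = 0) by omega) with f | f | f
      · refine lineMap_ne_of_orientation (-1) (Or.inl ⟨?_, ?_⟩) hs ht
        · exact orientation_cap_shrink_neg hδ f
        · exact (orientation_cap_outer_neg hδ (by omega)).le
      · refine lineMap_ne_of_orientation (-1) (Or.inr ⟨by rw [f.1], ?_⟩) hs ht
        exact orientation_cap_outer_neg hδ f.2
      · rw [f.1, f.2]
        refine lineMap_ne_of_orientation 1 (Or.inr ⟨rfl, ?_⟩) hs ht
        have := orientation_spiralPoint_tip hδ (t := 1) (by norm_num)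
        rwa [one_smul, ← one_mul (orientation _ _ _)] at this
    · obtain ⟨J, hJ⟩ : ∃ J, 2 * h - l = J + 1 := ⟨2 * h - l - 1, by omega⟩
      rw [bandVertex_inner δ e (by omega) hJ,
        bandVertex_inner δ (j := J) (by omega : h < l + 1) (by omega) (by omega)]
      rcases (show q < J ∨ (q = J ∧ 0 < J) ∨ (q = 0 ∧ J = 0) by omega) with f | f | f
      · refine lineMap_ne_of_orientation (-1) (Or.inl ⟨?_, ?_⟩) hs ht
        · exact orientation_shrink_shrink_neg hδ f
        · exact (orientation_shrink_outer_neg hδ (by omega)).le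
      · refine lineMap_ne_of_orientation (-1) (Or.inr ⟨by rw [f.1], ?_⟩) hs ht
        exact orientation_shrink_outer_neg hδ f.2
      · rw [f.1, f.2]
        refine lineMap_ne_of_orientation 1 (Or.inr ⟨rfl, ?_⟩) hs ht
        have := orientation_spiralPoint_tip hδ (t := 9 / 10) (by norm_num)
        rwa [← one_mul (orientation _ _ _)] at this

theorem orientation_bandVertex_pos (hδ : 0 < δ) (hm : m = 2 * h ∨ m = 2 * h + 1) (h3 : 3 ≤ m)
    {l : ℕ} (hl : l < h) : 0 < orientation (bandVertex δ h m l) (bandVertex δ h m (l + 1))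
      (bandVertex δ h m (l + 2)) := by
  rw [bandVertex_outer δ (by omega : l ≤ h), bandVertex_outer δ (by omega : l + 1 ≤ h)]
  rcases (show l + 2 ≤ h ∨ l + 1 = h by omega) with c | c
  · rw [bandVertex_outer δ c]
    exact orientation_spiralPoint_next_pos hδ l
  · rw [bandVertex_inner δ (j := l) (by omega) (by omega) (by omega)]
    exact orientation_spiralPoint_shrink_pos hδ (by omega)

theorem orientation_bandVertex_last_pos (hδ : 0 < δ) (hm : m = 2 * h ∨ m = 2 * h + 1)
    (h3 : 3 ≤ m) : 0 < orientation (bandVertex δ h m (m - 1)) (bandVertex δ h m 0)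
      (bandVertex δ h m 1) := by
  rw [bandVertex_outer δ (by omega : 0 ≤ h), bandVertex_outer δ (by omega : 1 ≤ h),
    bandVertex_inner δ (j := 2 * h - (m - 1)) (by omega) (by omega) rfl, ← orientation_rotate]
  exact orientation_spiralPoint_shrink_pos (k := 0) hδ (by omega)

theorem orientation_bandVertex_ne_zero (hδ : 0 < δ) (hm : m = 2 * h ∨ m = 2 * h + 1) (h3 : 3 ≤ m)
    {l : ℕ} (hl : l + 1 < m) : orientation (bandVertex δ h m l) (bandVertex δ h m (l + 1))
      (bandVertex δ h m (l + 2)) ≠ 0 := by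
  have neg : ∀ x : ℝ, 0 < -1 * x → x ≠ 0 := by
    rintro x hx rfl
    simp at hx
  rcases (show l < h ∨ l = h ∨ h < l by omega) with c | c | c
  · exact (orientation_bandVertex_pos hδ hm h3 c).ne'
  · obtain ⟨g, rfl⟩ : ∃ g, h = g + 1 := ⟨h - 1, by omega⟩
    subst c
    rw [bandVertex_outer δ (le_refl (g + 1)),
      bandVertex_inner δ (j := g) (by omega : g + 1 < g + 1 + 1) (by omega) (by omega)]
    rcases (show g + 1 + 2 < m ∨ (g + 1 + 2 = m ∧ g = 1) ∨ (g + 1 + 2 = m ∧ g = 0) by omega)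
      with e | e | e
    · rw [bandVertex_inner δ (j := g - 1) (by omega : g + 1 < g + 1 + 2) (by omega) (by omega)]
      exact neg _ (orientation_cap_shrink_neg hδ (by omega))
    · rw [bandVertex_add δ (j := 0) (by omega) (by omega)]
      exact neg _ (orientation_cap_outer_neg hδ (by omega))
    · rw [bandVertex_add δ (j := 0) (by omega) (by omega), e.2]
      have := orientation_spiralPoint_tip hδ (t := 1) (by norm_num)
      rw [one_smul] at this
      exact this.ne'
  · obtain ⟨j, hj⟩ : ∃ j, 2 * h - l = j + 1 := ⟨2 * h - l - 1, by omega⟩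
    rw [bandVertex_inner δ c (by omega) hj,
      bandVertex_inner δ (j := j) (by omega : h < l + 1) (by omega) (by omega)]
    rcases (show l + 2 < m ∨ (l + 2 = m ∧ j = 1) ∨ (l + 2 = m ∧ j = 0) by omega) with e | e | e
    · rw [bandVertex_inner δ (j := j - 1) (by omega : h < l + 2) e (by omega)]
      exact neg _ (orientation_shrink_shrink_neg hδ (by omega))
    · rw [bandVertex_add δ (j := 0) (by omega) (by omega)]
      exact neg _ (orientation_shrink_outer_neg hδ (by omega))
    · rw [bandVertex_add δ (j := 0) (by omega) (by omega), e.2]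
      exact (orientation_spiralPoint_tip hδ (t := 9 / 10) (by norm_num)).ne'

theorem planeCross_smul_spiralPoint (δ s t : ℝ) (i j : ℕ) :
    planeCross (s • spiralPoint δ i) (t • spiralPoint δ j) =
      δ * (s * t * ((-4) ^ i * (-2) ^ j - (-2) ^ i * (-4) ^ j)) := by
  simp only [planeCross, spiralPoint, Complex.smul_re, Complex.smul_im, smul_eq_mul]
  ring

theorem planeCross_spiralPoint_succ (δ s t : ℝ) (i : ℕ) :
    planeCross (s • spiralPoint δ i) (t • spiralPoint δ (i + 1)) = s * t * (δ * (2 * 8 ^ i)) := by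
  rw [planeCross_smul_spiralPoint, ← neg_four_pow_mul_neg_two_pow]
  simp only [pow_succ]
  ring

theorem planeCross_swap (a b : ℂ) : planeCross a b = -planeCross b a := by
  unfold planeCross; ring

theorem sum_planeCross_bandVertex_pos (hδ : 0 < δ) (hm : m = 2 * h ∨ m = 2 * h + 1) (h3 : 3 ≤ m) :
    0 < ∑ l ∈ Finset.range m, planeCross (bandVertex δ h m l) (bandVertex δ h m (l + 1)) := by
  set F : ℕ → ℝ := fun l => planeCross (bandVertex δ h m l) (bandVertex δ h m (l + 1)) with hF
  have hred : ∑ l ∈ Finset.range m, F l = ∑ l ∈ Finset.range (2 * h), F l := by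
    rcases hm with rfl | rfl
    · rfl
    -- For odd `m` the closing edge is radial, so its cross product is zero.
    · rw [Finset.sum_range_succ, add_eq_left]
      simp only [hF]
      rw [bandVertex_inner δ (j := 0) (by omega) (by omega) (by omega),
        bandVertex_add δ (j := 0) (by omega) (by omega)]
      simp [planeCross]
      ring
  -- Each outward edge is paired with the returning edge over the same step of the spiral, whose
  -- contribution is opposite and multiplied by a factor `s * t < 1`.
  have hpair : ∀ l ∈ Finset.range h, 0 < F l + F (h + (h - 1 - l)) := by
    intro l hl
    have hl := Finset.mem_range.1 hl
    have hX : 0 < δ * (2 * (8 : ℝ) ^ l) := by positivity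
    have e1 : F l = δ * (2 * 8 ^ l) := by
      have := planeCross_spiralPoint_succ δ 1 1 l
      rw [one_smul, one_smul, one_mul, one_mul] at this
      simp only [hF]
      rw [bandVertex_outer δ (by omega : l ≤ h), bandVertex_outer δ (by omega : l + 1 ≤ h), this]
    have hsmul : ∃ s t : ℝ, (s = 1 ∧ t = 9 / 10 ∨ s = 9 / 10 ∧ t = 1 ∨ s = 9 / 10 ∧ t = 9 / 10) ∧
        bandVertex δ h m (h + (h - 1 - l)) = t • spiralPoint δ (l + 1) ∧
        bandVertex δ h m (h + (h - 1 - l) + 1) = s • spiralPoint δ l := by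
      rcases (show l + 1 = h ∨ (l + 1 < h ∧ h + (h - 1 - l) + 1 < m) ∨
        (l + 1 < h ∧ h + (h - 1 - l) + 1 = m ∧ l = 0) by omega) with c | c | c
      · refine ⟨9 / 10, 1, by norm_num, ?_, ?_⟩
        · rw [one_smul, bandVertex_outer δ (by omega)]; congr 1; omega
        · exact bandVertex_inner δ (by omega) (by omega) (by omega)
      · exact ⟨9 / 10, 9 / 10, by norm_num, bandVertex_inner δ (by omega) (by omega) (by omega),
          bandVertex_inner δ (by omega) (by omega) (by omega)⟩
      · refine ⟨1, 9 / 10, by norm_num, bandVertex_inner δ (by omega) (by omega) (by omega), ?_⟩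
        rw [one_smul]
        exact bandVertex_add δ (by omega) (by omega)
    obtain ⟨s, t, hst, e2, e3⟩ := hsmul
    have e4 : F (h + (h - 1 - l)) = -(s * t * (δ * (2 * 8 ^ l))) := by
      simp only [hF]
      rw [e2, e3, planeCross_swap, planeCross_spiralPoint_succ]
    rw [e1, e4]
    rcases hst with ⟨rfl, rfl⟩ | ⟨rfl, rfl⟩ | ⟨rfl, rfl⟩ <;> linarith
  rw [hred, two_mul, Finset.sum_range_add, ← Finset.sum_range_reflect (fun l => F (h + l)),
    ← Finset.sum_add_distrib]
  exact Finset.sum_pos hpair (Finset.nonempty_range_iff.2 (by omega))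

end

/-! ### The band as a polygon, and its turns in the flat limit -/

/-- A simple polygon with `m` vertices whose edges all become horizontal as `δ → 0`. -/
def spiralBand (δ : ℝ) (m : ℕ) : Polygon ℂ m := ⟨fun j => bandVertex δ (m / 2) m j⟩

theorem spiralBand_apply (δ : ℝ) {m : ℕ} (j : Fin m) : spiralBand δ m j = bandVertex δ (m / 2) m j := rfl

theorem bandVertex_flatten (δ : ℝ) (h m l : ℕ) : bandVertex δ h m l =
    ⟨(bandVertex 1 h m l).re, δ * (bandVertex 1 h m l).im⟩ := by
  unfold bandVertex
  split_ifs <;> apply Complex.ext <;>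
    simp only [spiralPoint, Complex.smul_re, Complex.smul_im, smul_eq_mul] <;> ring

section

variable {δ : ℝ} {m : ℕ} [NeZero m]

theorem spiralBand_add_one (h3 : 3 ≤ m) (j : Fin m) :
    spiralBand δ m (j + 1) = bandVertex δ (m / 2) m (j + 1) := by
  rw [spiralBand_apply]
  have hv : (j + 1 : Fin m).val = (j.val + 1) % m := by simp [Fin.val_add]
  rw [hv]
  rcases (show j.val + 1 < m ∨ j.val + 1 = m by omega) with c | c
  · rw [Nat.mod_eq_of_lt c]
  · rw [c, Nat.mod_self, bandVertex_add δ (j := 0) (by omega) (show m = m + 0 from rfl),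
      bandVertex_outer δ (by omega)]

theorem spiralBand_isSimple (hδ : 0 < δ) (h3 : 3 ≤ m)
    (hnd : (spiralBand δ m).HasNondegenerateVertices ℝ) : (spiralBand δ m).IsSimple := by
  have hedge := hnd.hasNondegenerateEdges
  rintro ⟨i, s⟩ ⟨-, hs⟩ ⟨j, t⟩ ⟨-, ht⟩ heq
  simp only [Polygon.edgePath, finRotate_eq_add_one] at heq
  rcases lt_trichotomy i j with hij | rfl | hij
  · rw [spiralBand_add_one h3, spiralBand_add_one h3] at heq
    exact absurd heq (lineMap_bandVertex_ne hδ (by omega) h3 hij j.2 hs ht)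
  · have := hedge i
    rw [finRotate_eq_add_one] at this
    rw [AffineMap.lineMap_injective ℝ this heq]
  · rw [spiralBand_add_one h3, spiralBand_add_one h3] at heq
    exact absurd heq.symm (lineMap_bandVertex_ne hδ (by omega) h3 hij i.2 ht hs)

theorem spiralBand_hasNondegenerateVertices (hδ : 0 < δ) (h3 : 3 ≤ m) :
    (spiralBand δ m).HasNondegenerateVertices ℝ := by
  intro i
  apply affineIndependent_of_orientation
  have h2 : i + 2 = i + 1 + 1 := by
    ext
    simp [Fin.val_add, add_assoc]
  rw [h2, spiralBand_add_one h3 i, spiralBand_add_one h3 (i + 1), spiralBand_apply]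
  have hv : (i + 1 : Fin m).val = (i.val + 1) % m := by simp [Fin.val_add]
  rw [hv]
  rcases (show i.val + 1 < m ∨ i.val + 1 = m by omega) with c | c
  · rw [Nat.mod_eq_of_lt c]
    exact orientation_bandVertex_ne_zero hδ (by omega) h3 c
  · have := (orientation_bandVertex_last_pos (h := m / 2) hδ (by omega) h3).ne'
    rw [c, Nat.mod_self, bandVertex_add δ (j := 0) (by omega) (show m = m + 0 from rfl)]
    rw [bandVertex_outer δ (by omega : 0 ≤ m / 2)] at this
    rwa [show i.val = m - 1 by omega]

theorem spiralBand_isCounterclockwise (hδ : 0 < δ) (h3 : 3 ≤ m) :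
    (spiralBand δ m).IsCounterclockwise := by
  have := sum_planeCross_bandVertex_pos (h := m / 2) hδ (by omega) h3
  rw [Finset.sum_range] at this
  unfold Polygon.IsCounterclockwise Polygon.signedArea
  simp only [spiralBand_add_one h3, spiralBand_apply]
  have e : ∀ a b : ℂ, a.re * b.im - b.re * a.im = planeCross a b := by
    intro a b; unfold planeCross; ring
  simp only [e]
  linarith

theorem spiralBand_vertexFrom_last (h3 : 3 ≤ m) (i : Fin m) (hi : i.val = m - 1) {k : ℕ}
    (hk : k < m) : (spiralBand δ m).vertexFrom i (k + 1) = bandVertex δ (m / 2) m k := by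
  rw [Polygon.vertexFrom, spiralBand_apply]
  congr 1
  rw [Fin.val_add, Fin.ofNat_eq_cast, Fin.val_natCast, Nat.add_mod_mod, hi,
    show m - 1 + (k + 1) = k + m by omega, Nat.add_mod_right, Nat.mod_eq_of_lt hk]

end

open Filter Topology in
/-- The turning angle between two edges of opposite horizontal directions forming a left turn
tends to `π` when the figure is flattened. -/
theorem tendsto_arg_flatten {x y x' y' : ℝ} (hx : x * x' < 0) (hc : 0 ≤ x * y' - y * x') :
    Tendsto (fun δ : ℝ => Complex.arg ((⟨x', δ * y'⟩ : ℂ) / ⟨x, δ * y⟩)) (𝓝[>] 0) (𝓝 π) := by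
  have hx0 : x ≠ 0 := by rintro rfl; simp at hx
  have hneg : x' / x < 0 := by
    rw [div_neg_iff]
    rcases mul_neg_iff.1 hx with h | h
    · exact Or.inr ⟨h.2, h.1⟩
    · exact Or.inl ⟨h.2, h.1⟩
  have hmk : ∀ a b δ : ℝ, (⟨a, δ * b⟩ : ℂ) = a + (δ : ℂ) * b * Complex.I := by
    intro a b δ
    apply Complex.ext <;> simp
  have hlim : Tendsto (fun δ : ℝ => (⟨x', δ * y'⟩ : ℂ) / ⟨x, δ * y⟩) (𝓝 0)
      (𝓝 ((x' / x : ℝ) : ℂ)) := by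
    have hcont : ContinuousAt (fun δ : ℝ => (⟨x', δ * y'⟩ : ℂ) / ⟨x, δ * y⟩) 0 := by
      simp only [hmk]
      refine ContinuousAt.div (by fun_prop) (by fun_prop) ?_
      simpa using hx0
    have := hcont.tendsto
    rw [hmk, hmk] at this
    simpa using this
  have harg := (Complex.continuousWithinAt_arg_of_re_neg_of_im_zero (z := ((x' / x : ℝ) : ℂ))
    (by rwa [Complex.ofReal_re]) (Complex.ofReal_im _)).tendsto
  rw [Complex.arg_ofReal_of_neg hneg] at harg
  -- The quotient tends to a negative real number. The left turn keeps it in the closed upper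
  -- half-plane, so its argument tends to `π` and not to `-π`.
  refine harg.comp (tendsto_nhdsWithin_iff.2 ⟨hlim.mono_left nhdsWithin_le_nhds, ?_⟩)
  filter_upwards [self_mem_nhdsWithin] with δ hδ
  have hδ : 0 < δ := hδ
  change 0 ≤ Complex.im _
  rw [Complex.div_im, ← sub_div]
  refine div_nonneg ?_ (Complex.normSq_nonneg _)
  have := mul_nonneg hδ.le hc
  linarith

section

variable {m : ℕ} [NeZero m]

open Filter Topology

theorem tendsto_turn_spiralBand (h3 : 3 ≤ m) (i : Fin m) (hi : i.val = m - 1) {k : ℕ}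
    (hk : k ≤ m / 2) :
    Tendsto (fun δ => (spiralBand δ m).turn i (k + 1)) (𝓝[>] 0) (𝓝 π) := by
  have key : ∀ p q r : ℕ,
      (∀ δ, (spiralBand δ m).turn i (k + 1) = Complex.arg
        ((bandVertex δ (m / 2) m r - bandVertex δ (m / 2) m q) /
          (bandVertex δ (m / 2) m q - bandVertex δ (m / 2) m p))) →
      ((bandVertex 1 (m / 2) m q).re - (bandVertex 1 (m / 2) m p).re) *
        ((bandVertex 1 (m / 2) m r).re - (bandVertex 1 (m / 2) m q).re) < 0 →
      0 ≤ orientation (bandVertex 1 (m / 2) m p) (bandVertex 1 (m / 2) m q)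
        (bandVertex 1 (m / 2) m r) →
      Tendsto (fun δ => (spiralBand δ m).turn i (k + 1)) (𝓝[>] 0) (𝓝 π) := by
    intro p q r h1 h2 h4
    refine (tendsto_arg_flatten h2
      (y := (bandVertex 1 (m / 2) m q).im - (bandVertex 1 (m / 2) m p).im)
      (y' := (bandVertex 1 (m / 2) m r).im - (bandVertex 1 (m / 2) m q).im) h4).congr fun δ => ?_
    rw [h1, bandVertex_flatten δ (m / 2) m p, bandVertex_flatten δ (m / 2) m q,
      bandVertex_flatten δ (m / 2) m r]
    congr 2 <;> apply Complex.ext <;> simp [mul_sub]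
  have hpow : ∀ j : ℕ, 0 < ((-4 : ℝ) ^ j) ^ 2 := fun j => by positivity
  -- Seen from vertex `m - 1`, the turn of index `k + 1` is at vertex `k`. Vertex `0` is separate
  -- because the edge arriving there closes the polygon.
  rcases Nat.eq_zero_or_pos k with rfl | hk0
  · refine key (m - 1) 0 1 (fun δ => ?_) ?_
      (orientation_bandVertex_last_pos one_pos (by omega) h3).le
    · rw [Polygon.turn, Polygon.edgeVec_eq, Polygon.edgeVec_eq,
        spiralBand_vertexFrom_last h3 i hi (by omega),
        spiralBand_vertexFrom_last h3 i hi (by omega), Polygon.vertexFrom_zero, spiralBand_apply,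
        hi]
    · rw [bandVertex_outer 1 (Nat.zero_le _), bandVertex_outer 1 (by omega : 1 ≤ m / 2),
        bandVertex_inner 1 (j := 2 * (m / 2) - (m - 1)) (by omega) (by omega) rfl]
      rcases (show 2 * (m / 2) - (m - 1) = 0 ∨ 2 * (m / 2) - (m - 1) = 1 by omega) with e | e <;>
        rw [e] <;> simp only [spiralPoint, Complex.smul_re, smul_eq_mul] <;> norm_num
  · obtain ⟨l, rfl⟩ : ∃ l, k = l + 1 := ⟨k - 1, by omega⟩
    refine key l (l + 1) (l + 2) (fun δ => ?_) ?_
      (orientation_bandVertex_pos one_pos (by omega) h3 (by omega)).le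
    · rw [Polygon.turn, Polygon.edgeVec_eq, Polygon.edgeVec_eq, Nat.add_sub_cancel,
        spiralBand_vertexFrom_last h3 i hi (by omega),
        spiralBand_vertexFrom_last h3 i hi (by omega), spiralBand_vertexFrom_last h3 i hi (by omega)]
    · have := hpow l
      rw [bandVertex_outer 1 (by omega : l ≤ m / 2), bandVertex_outer 1 hk]
      rcases (show l + 2 ≤ m / 2 ∨ l + 1 = m / 2 by omega) with e | e
      · rw [bandVertex_outer 1 e]
        simp only [spiralPoint, pow_add, pow_one]
        nlinarith
      · rw [bandVertex_inner 1 (j := l) (by omega) (by omega) (by omega)]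
        simp only [spiralPoint, Complex.smul_re, smul_eq_mul, pow_add, pow_one]
        nlinarith

theorem exists_spiralBand_turn_sum (h3 : 3 ≤ m) (i : Fin m) (hi : i.val = m - 1) {ε : ℝ}
    (hε : 0 < ε) : ∃ δ > 0, (((m / 2 : ℕ) : ℝ) + 1) * π - ε ≤
      ∑ k ∈ Finset.range (m / 2 + 1), (spiralBand δ m).turn i (k + 1) := by
  have hlim : Tendsto (fun δ => ∑ k ∈ Finset.range (m / 2 + 1), (spiralBand δ m).turn i (k + 1))
      (𝓝[>] 0) (𝓝 (∑ k ∈ Finset.range (m / 2 + 1), π)) :=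
    tendsto_finsetSum _ fun k hk =>
      tendsto_turn_spiralBand h3 i hi (Nat.lt_succ_iff.1 (Finset.mem_range.1 hk))
  rw [Finset.sum_const, Finset.card_range, nsmul_eq_mul, Nat.cast_add, Nat.cast_one] at hlim
  obtain ⟨δ, h1, h2⟩ := ((hlim.eventually (lt_mem_nhds (sub_lt_self _ hε))).and
    self_mem_nhdsWithin).exists
  exact ⟨δ, h2, h1.le⟩

end

end

theorem mainTheorem3 (m : ℕ) [NeZero m] (hm : 3 ≤ m) :
    (((m / 2 : ℕ) : ℝ) + 1) * π = lambdaConst m / 2 ∧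
    (∀ Q : Polygon ℂ m, Q.IsSimple → Q.IsCounterclockwise →
      ∀ (i : Fin m) (τ : ℝ), 0 ≤ τ → τ < 1 →
        ∃ d : ℝ, IsSpan (Q.turningFunction i τ) d ∧ d ≤ (((m / 2 : ℕ) : ℝ) + 1) * π) ∧
    (∀ ε : ℝ, 0 < ε →
      ∃ P : Polygon ℂ m, P.IsSimple ∧ P.IsCounterclockwise ∧ P.HasNondegenerateVertices ℝ ∧
        ∃ (i : Fin m) (τ : ℝ), 0 ≤ τ ∧ τ < 1 ∧
          ∃ d : ℝ, IsSpan (P.turningFunction i τ) d ∧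
            (((m / 2 : ℕ) : ℝ) + 1) * π - ε ≤ d) := by
  refine ⟨?_, ?_, ?_⟩
  · unfold lambdaConst
    ring
  · intro Q hQ hQ' i τ _ _
    obtain ⟨d, hd⟩ := hQ.exists_isSpan i τ
    exact ⟨d, hd, hQ.span_le hQ' (by omega) i τ hd⟩
  · intro ε hε
    -- Starting at the last vertex puts the large left turns, at vertices `0` to `m / 2`, at the
    -- beginning of the traversal.
    set i : Fin m := ⟨m - 1, by omega⟩
    obtain ⟨δ, hδ, hsum⟩ := exists_spiralBand_turn_sum hm i rfl hε
    have hnd := spiralBand_hasNondegenerateVertices hδ hm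
    have hs := spiralBand_isSimple hδ hm hnd
    obtain ⟨d, hd⟩ := hs.exists_isSpan i 0
    refine ⟨spiralBand δ m, hs, spiralBand_isCounterclockwise hδ hm, hnd, i, 0, le_rfl, one_pos,
      d, hd, hsum.trans ?_⟩
    have h1 := hd.sub_le (hs.arcLength_div_mem_Icc i (K := m / 2 + 1) (by omega))
      (hs.arcLength_div_mem_Icc i (K := 0) (Nat.zero_le _))
    rw [hs.turningFunction_arcLength i (by omega), hs.turningFunction_arcLength i (by omega),
      Finset.sum_range_zero] at h1
    linarith
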